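/- Let $(\Omega,\Sigma,\mu)$ be a measure space, let $p=1$ or $2<p<\infty$, and suppose that the real Banach space $X=L_p(\Omega,\Sigma,\mu)$ is infinite-dimensional. A real function on a convex subset $U$ of a real normed space is called delta-convex on $U$ if it is the difference of two continuous convex functions on $U$. A continuous mapping $\varphi\colon(0,1)\to X$ is called delta-convex if its right derivative $\varphi'_+(t)$ exists at each $t\in(0,1)$ and $\varphi'_+$ has bounded variation on each compact subinterval of $(0,1)$. Then there exists a continuous function $f\colon X\to\mathbb{R}$ such that (i) $f$ is delta-convex on no convex neighborhood of $0$ (in particular, $f$ is not locally delta-convex), and (ii) $f\circ\varphi$ is delta-convex on $(0,1)$ for each delta-convex mapping $\varphi\colon(0,1)\to X$. -/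

import Mathlib

open Set MeasureTheory Topology
open scoped ENNReal

/-- A real function `f` is delta-convex on the convex set `U` if, on `U`, it is the difference of
two continuous convex functions. -/
def DeltaConvexOn {E : Type*} [NormedAddCommGroup E] [NormedSpace ℝ E]
    (U : Set E) (f : E → ℝ) : Prop :=
  ∃ g h : E → ℝ, (ContinuousOn g U ∧ ConvexOn ℝ U g) ∧ (ContinuousOn h U ∧ ConvexOn ℝ U h) ∧
    ∀ x ∈ U, f x = g x - h x

/-- A mapping `φ` from an open interval `I` to a normed space is delta-convex if it is continuous,
it has a right derivative `φ'₊ t` at each `t ∈ I`, and `φ'₊` has bounded variation on each compact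
subinterval of `I`. Only the values of `φ` on `I` matter. -/
def DeltaConvexCurveOn {E : Type*} [NormedAddCommGroup E] [NormedSpace ℝ E]
    (I : Set ℝ) (φ : ℝ → E) : Prop :=
  ContinuousOn φ I ∧
    ∃ φ' : ℝ → E, (∀ t ∈ I, HasDerivWithinAt φ (φ' t) (Ioi t) t) ∧ LocallyBoundedVariationOn φ' I

/-! It suffices to find `f` with two properties. The first is a first-order expansion whose error is
at most `C * ‖h‖ ^ 2` everywhere (`QuadApprox`). Then the derivative `D` of `f` is Lipschitz, and `f
∘ φ` has right derivative `D (φ t) (φ' t)`. This is a Lipschitz function paired with one of bounded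
variation, hence of locally bounded variation, and integrating its Jordan decomposition makes `f ∘
φ` delta-convex.

The second property obstructs delta-convexity near `0`. If `f = g - h` with `g`, `h` convex, then `g
+ h` dominates the second differences of `f`. Along a tree of depth `n` with second differences at
least `δ`, it must lie at the root `n * δ / 2` below its upper bound. Since `g + h` is bounded near
`0`, it is enough that every ball around `0` contains trees with `n * δ` arbitrarily large.

Infinite dimension provides infinitely many disjoint sets of positive finite measure, whose
normalized indicators span a copy of `ℓᵖ` with biorthogonal functionals. For `p > 2` the space is
2-smooth, so it carries bumps of height `ε ^ 2` and radius `ε / 4` with a uniform `C`. They are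
placed at the odd levels of the tree of sign vectors `∑ ± ε e_i`. Depth `N` gives total `N * ε ^ 2`
in a ball of radius about `N ^ (1 / p) * ε`, so the total can be large while the radius is small.
For `p = 1`, `f` is a quadratic form given by a matrix of signs on binary words. Averages of basis
vectors over descendants form trees of any depth in the unit ball, with second differences bounded
below, and scaling brings them into any ball. -/

/-! ### Trees as an obstruction to delta-convexity -/

/-- A binary tree of depth `n` rooted at `x` inside `U` along which the second differences of `f`
are at least `δ` in absolute value. -/
def HasTree {E : Type*} [AddCommGroup E] (f : E → ℝ) (U : Set E) (δ : ℝ) : ℕ → E → Prop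
  | 0, x => x ∈ U
  | n + 1, x => x ∈ U ∧ ∃ v, δ ≤ |f (x + v) + f (x - v) - 2 * f x| ∧
      HasTree f U δ n (x + v) ∧ HasTree f U δ n (x - v)

theorem HasTree.mem {E : Type*} [AddCommGroup E] {f : E → ℝ} {U : Set E} {δ : ℝ} {n : ℕ} {x : E}
    (h : HasTree f U δ n x) : x ∈ U := by
  cases n with
  | zero => exact h
  | succ n => exact h.1

/-- Each level costs `δ / 2`: at a node, `c` lies at least `δ / 2` below the mean of its values at
the two children. -/
theorem HasTree.le_sub {E : Type*} [AddCommGroup E] {f c : E → ℝ} {U : Set E} {δ M : ℝ}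
    (hc : ∀ x v, x ∈ U → x + v ∈ U → x - v ∈ U →
      |f (x + v) + f (x - v) - 2 * f x| ≤ c (x + v) + c (x - v) - 2 * c x)
    (hM : ∀ x ∈ U, c x ≤ M) : ∀ {n : ℕ} {x : E}, HasTree f U δ n x → c x ≤ M - n * (δ / 2)
  | 0, x, h => by simpa using hM x h
  | n + 1, x, ⟨hx, v, hv, h₁, h₂⟩ => by
    have := hc x v hx h₁.mem h₂.mem
    have := h₁.le_sub hc hM
    have := h₂.le_sub hc hM
    push_cast
    linarith

/-- The control function is `g + h`: second differences of `g` and `h` are nonnegative, so their sum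
bounds the absolute value of their difference. -/
theorem not_deltaConvexOn_of_hasTree {E : Type*} [NormedAddCommGroup E] [NormedSpace ℝ E]
    {f : E → ℝ}
    (hf : ∀ r > 0, ∀ K : ℝ, ∃ (n : ℕ) (δ : ℝ) (x : E),
      K < n * δ ∧ HasTree f (Metric.ball 0 r) δ n x)
    {U : Set E} (hU : U ∈ 𝓝 (0 : E)) : ¬ DeltaConvexOn U f := by
  rintro ⟨g, h, ⟨hgc, hg⟩, ⟨hhc, hh⟩, hfgh⟩
  have hcont : ContinuousAt (fun x => g x + h x) 0 :=
    (hgc.continuousAt hU).add (hhc.continuousAt hU)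
  obtain ⟨r, hr, hball⟩ := Metric.mem_nhds_iff.1
    (Filter.inter_mem hU (hcont (Metric.ball_mem_nhds _ one_pos)))
  set m := g 0 + h 0
  have hbd : ∀ x ∈ Metric.ball (0 : E) r, |g x + h x - m| < 1 := fun x hx => by
    simpa [Real.dist_eq] using (hball hx).2
  -- On the ball `g + h` stays within `1` of `m`; a total above `4` would push the root below `m + 1
  -- - 2`.
  obtain ⟨n, δ, x, hK, ht⟩ := hf r hr 4
  have hmid : ∀ {k : E → ℝ}, ConvexOn ℝ U k → ∀ x v, x + v ∈ U → x - v ∈ U →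
      0 ≤ k (x + v) + k (x - v) - 2 * k x := by
    intro k hk x v h₁ h₂
    have := hk.2 h₁ h₂ (by norm_num : (0 : ℝ) ≤ 1 / 2) (by norm_num : (0 : ℝ) ≤ 1 / 2) (by norm_num)
    rw [← smul_add, show x + v + (x - v) = (2 : ℝ) • x by rw [two_smul]; abel, smul_smul] at this
    norm_num at this
    linarith
  have key := ht.le_sub (c := fun x => g x + h x) (M := m + 1) (fun x v hx h₁ h₂ => by
    have a := hmid hg x v (hball h₁).1 (hball h₂).1
    have b := hmid hh x v (hball h₁).1 (hball h₂).1
    rw [hfgh _ (hball h₁).1, hfgh _ (hball h₂).1, hfgh _ (hball hx).1, abs_le]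
    constructor <;> linarith) (fun x hx => by linarith [(abs_lt.1 (hbd x hx)).2])
  have := (abs_lt.1 (hbd x ht.mem)).1
  linarith

/-! ### Delta-convexity on an interval -/

/-- Primitives of monotone functions are continuous and convex. -/
theorem MonotoneOn.continuousOn_convexOn_primitive {u : ℝ → ℝ} {a b c : ℝ} (hc : c ∈ Ioo a b)
    (hu : MonotoneOn u (Ioo a b)) :
    ContinuousOn (fun t => ∫ s in c..t, u s) (Ioo a b) ∧
      ConvexOn ℝ (Ioo a b) (fun t => ∫ s in c..t, u s) := by
  have hint : ∀ x ∈ Ioo a b, ∀ y ∈ Ioo a b, IntervalIntegrable u volume x y := fun x hx y hy =>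
    (hu.mono (ordConnected_Ioo.uIcc_subset hx hy)).intervalIntegrable
  have hsub : ∀ x ∈ Ioo a b, ∀ y ∈ Ioo a b,
      (∫ s in c..y, u s) - ∫ s in c..x, u s = ∫ s in x..y, u s := fun x hx y hy =>
    intervalIntegral.integral_interval_sub_left (hint c hc y hy) (hint c hc x hx)
  have hlow : ∀ x ∈ Ioo a b, ∀ y ∈ Ioo a b, x ≤ y → (y - x) * u x ≤ ∫ s in x..y, u s := by
    intro x hx y hy hxy
    have := intervalIntegral.integral_mono_on (μ := volume) (f := fun _ => u x) (g := u) hxy (by simp)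
      (hint x hx y hy)
      (fun s hs => hu hx ⟨hx.1.trans_le hs.1, hs.2.trans_lt hy.2⟩ hs.1)
    simpa using this
  have hup : ∀ x ∈ Ioo a b, ∀ y ∈ Ioo a b, x ≤ y → ∫ s in x..y, u s ≤ (y - x) * u y := by
    intro x hx y hy hxy
    have := intervalIntegral.integral_mono_on (μ := volume) (f := u) (g := fun _ => u y) hxy
      (hint x hx y hy) (by simp)
      (fun s hs => hu ⟨hx.1.trans_le hs.1, hs.2.trans_lt hy.2⟩ hy hs.2)
    simpa using this
  have hconv : ConvexOn ℝ (Ioo a b) (fun t => ∫ s in c..t, u s) := by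
    refine convexOn_of_slope_mono_adjacent (convex_Ioo a b) ?_
    intro x y z hx hz hxy hyz
    have hy : y ∈ Ioo a b := ⟨hx.1.trans hxy, hyz.trans hz.2⟩
    rw [hsub x hx y hy, hsub y hy z hz]
    -- The value `u y` separates the slopes on the two sides of `y`.
    refine le_trans (b := u y) ?_ ?_
    · rw [div_le_iff₀ (by linarith)]
      linarith [hup x hx y hy hxy.le]
    · rw [le_div_iff₀ (by linarith)]
      linarith [hlow y hy z hz hyz.le]
  exact ⟨hconv.continuousOn isOpen_Ioo, hconv⟩

/-- A continuous function with a right derivative of locally bounded variation is delta-convex. -/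
theorem deltaConvexOn_of_hasDerivWithinAt {F ψ : ℝ → ℝ} {a b : ℝ} (hab : a < b)
    (hF : ContinuousOn F (Ioo a b)) (hd : ∀ t ∈ Ioo a b, HasDerivWithinAt F (ψ t) (Ioi t) t)
    (hψ : LocallyBoundedVariationOn ψ (Ioo a b)) : DeltaConvexOn (Ioo a b) F := by
  obtain ⟨u, w, hu, hw, rfl⟩ := hψ.exists_monotoneOn_sub_monotoneOn
  have hc : (a + b) / 2 ∈ Ioo a b := ⟨by linarith, by linarith⟩
  set c := (a + b) / 2
  obtain ⟨hu₁, hu₂⟩ := hu.continuousOn_convexOn_primitive hc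
  obtain ⟨hw₁, hw₂⟩ := hw.continuousOn_convexOn_primitive hc
  refine ⟨fun t => (∫ s in c..t, u s) + F c, _, ⟨hu₁.add continuousOn_const, hu₂.add_const _⟩,
    ⟨hw₁, hw₂⟩, fun t ht => ?_⟩
  have hsub := ordConnected_Ioo.uIcc_subset hc ht
  have hiu : IntervalIntegrable u volume c t := (hu.mono hsub).intervalIntegrable
  have hiw : IntervalIntegrable w volume c t := (hw.mono hsub).intervalIntegrable
  have := intervalIntegral.integral_eq_sub_of_hasDeriv_right (hF.mono hsub)
    (fun x hx => hd x (hsub ⟨hx.1.le, hx.2.le⟩)) (hiu.sub hiw)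
  simp only [Pi.sub_apply] at this
  rw [intervalIntegral.integral_sub hiu hiw] at this
  simp only
  linarith

/-! ### Uniform quadratic approximation and composition with curves -/

/-- `D` is a first-order approximation of `f` with a uniform quadratic error. -/
def QuadApprox {E : Type*} [NormedAddCommGroup E] [NormedSpace ℝ E] (C : ℝ) (f : E → ℝ)
    (D : E → E →L[ℝ] ℝ) : Prop :=
  ∀ x h, |f (x + h) - f x - D x h| ≤ C * ‖h‖ ^ 2

section QuadApprox

variable {E : Type*} [NormedAddCommGroup E] [NormedSpace ℝ E] {C : ℝ} {f : E → ℝ}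
  {D : E → E →L[ℝ] ℝ}

theorem QuadApprox.hasFDerivAt (hf : QuadApprox C f D) (x : E) : HasFDerivAt f (D x) x := by
  rw [hasFDerivAt_iff_isLittleO_nhds_zero]
  refine Asymptotics.IsBigO.trans_isLittleO (g := fun h : E => ‖h‖ ^ 2)
    (Asymptotics.IsBigO.of_bound C (Filter.Eventually.of_forall fun h => ?_)) ?_
  · simpa using hf x h
  · exact Asymptotics.isLittleO_norm_pow_id one_lt_two

theorem QuadApprox.continuous (hf : QuadApprox C f D) : Continuous f :=
  continuous_iff_continuousAt.2 fun x => (hf.hasFDerivAt x).continuousAt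

/-- Expand `f (y + k)` from `x` directly and by way of `y`, with `‖k‖ = ‖y - x‖`. The three errors
add up to `(4 + 1 + 1) * C * ‖y - x‖ ^ 2`. -/
theorem QuadApprox.norm_sub_le (hf : QuadApprox C f D) (hC : 0 ≤ C) (x y : E) :
    ‖D y - D x‖ ≤ 6 * C * ‖y - x‖ := by
  rcases eq_or_ne x y with rfl | hxy
  · simp
  have hpos : 0 < ‖y - x‖ := norm_pos_iff.2 (sub_ne_zero.2 hxy.symm)
  refine ContinuousLinearMap.opNorm_le_of_unit_norm (by positivity) fun z hz => ?_
  set k : E := ‖y - x‖ • z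
  have hk : ‖k‖ = ‖y - x‖ := by simp [k, norm_smul, hz]
  have h₁ := hf x (y - x + k)
  have h₂ := hf x (y - x)
  have h₃ := hf y k
  rw [show x + (y - x + k) = y + k by abel, map_add] at h₁
  rw [show x + (y - x) = y by abel] at h₂
  rw [hk] at h₃
  have h₄ : C * ‖y - x + k‖ ^ 2 ≤ C * (2 * ‖y - x‖) ^ 2 := by
    gcongr
    calc _ ≤ ‖y - x‖ + ‖k‖ := norm_add_le _ _
      _ = _ := by rw [hk]; ring
  have h₅ : |(D y - D x) k| ≤ 6 * C * ‖y - x‖ ^ 2 := by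
    rw [_root_.sub_apply]
    rw [abs_le] at *
    constructor <;> nlinarith
  have h₆ : (D y - D x) k = ‖y - x‖ * (D y - D x) z := by simp [k]
  rw [h₆, abs_mul, abs_of_pos hpos] at h₅
  rw [Real.norm_eq_abs]
  nlinarith

end QuadApprox

theorem eVariationOn_le_of_edist_le {α E F G : Type*} [LinearOrder α] [PseudoEMetricSpace E]
    [PseudoEMetricSpace F] [PseudoEMetricSpace G] {f : α → E} {g : α → F} {k : α → G} {s : Set α}
    {a b : ℝ≥0∞}
    (h : ∀ x ∈ s, ∀ y ∈ s, edist (f x) (f y) ≤ a * edist (g x) (g y) + b * edist (k x) (k y)) :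
    eVariationOn f s ≤ a * eVariationOn g s + b * eVariationOn k s := by
  refine iSup_le fun ⟨n, u, hu, hus⟩ => ?_
  calc _ ≤ ∑ i ∈ Finset.range n, (a * edist (g (u (i + 1))) (g (u i)) +
          b * edist (k (u (i + 1))) (k (u i))) :=
        Finset.sum_le_sum fun i _ => h _ (hus _) _ (hus _)
    _ = a * ∑ i ∈ Finset.range n, edist (g (u (i + 1))) (g (u i)) +
          b * ∑ i ∈ Finset.range n, edist (k (u (i + 1))) (k (u i)) := by
        rw [Finset.sum_add_distrib, Finset.mul_sum, Finset.mul_sum]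
    _ ≤ _ := by
        gcongr
        · exact eVariationOn.sum_le hu (fun i => hus i)
        · exact eVariationOn.sum_le hu (fun i => hus i)

theorem QuadApprox.deltaConvexOn_comp {E : Type*} [NormedAddCommGroup E] [NormedSpace ℝ E] {C : ℝ}
    {f : E → ℝ} {D : E → E →L[ℝ] ℝ} (hf : QuadApprox C f D) (hC : 0 ≤ C) {φ : ℝ → E} {a b : ℝ}
    (hab : a < b) (hφ : DeltaConvexCurveOn (Ioo a b) φ) : DeltaConvexOn (Ioo a b) (f ∘ φ) := by
  obtain ⟨hφc, φ', hφ', hbv⟩ := hφ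
  refine deltaConvexOn_of_hasDerivWithinAt (ψ := fun t => D (φ t) (φ' t)) hab
    (hf.continuous.comp_continuousOn hφc)
    (fun t ht => (hf.hasFDerivAt (φ t)).comp_hasDerivWithinAt t (hφ' t ht)) ?_
  intro s t hs ht
  have hsub : Icc s t ⊆ Ioo a b := ordConnected_Ioo.out hs ht
  rw [inter_eq_right.2 hsub]
  have hbv' : BoundedVariationOn φ' (Icc s t) := by
    simpa [inter_eq_right.2 hsub] using hbv s t hs ht
  rcases lt_or_ge t s with hts | hst
  · simp [hts, BoundedVariationOn]
  -- Bounded variation bounds `φ'` on the segment, so `φ` is Lipschitz there by the mean value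
  -- inequality for right derivatives.
  obtain ⟨M, hM0, hM⟩ : ∃ M, 0 ≤ M ∧ ∀ x ∈ Icc s t, ‖φ' x‖ ≤ M := by
    refine ⟨‖φ' s‖ + (eVariationOn φ' (Icc s t)).toReal, by positivity, fun x hx => ?_⟩
    have := hbv'.dist_le hx (left_mem_Icc.2 hst)
    rw [dist_eq_norm] at this
    linarith [norm_sub_norm_le (φ' x) (φ' s)]
  have hLip : ∀ x ∈ Icc s t, ∀ y ∈ Icc s t, ‖φ x - φ y‖ ≤ M * |x - y| := by
    have : ∀ x ∈ Icc s t, ∀ y ∈ Icc s t, x ≤ y → ‖φ y - φ x‖ ≤ M * (y - x) := by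
      intro x hx y hy hxy
      have hxyI : Icc x y ⊆ Icc s t := Icc_subset_Icc hx.1 hy.2
      exact norm_image_sub_le_of_norm_deriv_right_le_segment
        (hφc.mono (hxyI.trans hsub)) (fun z hz => (hφ' z (hsub (hxyI ⟨hz.1, hz.2.le⟩))).Ici_of_Ioi)
        (fun z hz => hM z (hxyI ⟨hz.1, hz.2.le⟩)) y (right_mem_Icc.2 hxy)
    intro x hx y hy
    rcases le_total x y with h | h
    · rw [norm_sub_rev, abs_sub_comm, abs_of_nonneg (sub_nonneg.2 h)]
      exact this x hx y hy h
    · rw [abs_of_nonneg (sub_nonneg.2 h)]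
      exact this y hy x hx h
  obtain ⟨R, hR0, hR⟩ : ∃ R, 0 ≤ R ∧ ∀ x ∈ Icc s t, ‖D (φ x)‖ ≤ R := by
    refine ⟨‖D (φ s)‖ + 6 * C * (M * (t - s)), by have := sub_nonneg.2 hst; positivity,
      fun x hx => ?_⟩
    have h₁ := hf.norm_sub_le hC (φ s) (φ x)
    have h₂ := hLip x hx s (left_mem_Icc.2 hst)
    have h₃ : M * |x - s| ≤ M * (t - s) := by
      gcongr
      rw [abs_of_nonneg (sub_nonneg.2 hx.1)]
      linarith [hx.2]
    have h₄ : 6 * C * ‖φ x - φ s‖ ≤ 6 * C * (M * (t - s)) := by gcongr; exact h₂.trans h₃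
    linarith [norm_sub_norm_le (D (φ x)) (D (φ s))]
  have hvar : eVariationOn (fun t => D (φ t) (φ' t)) (Icc s t) ≤
      ENNReal.ofReal (6 * C * M * M) * eVariationOn (fun x : ℝ => x) (Icc s t) +
        ENNReal.ofReal R * eVariationOn φ' (Icc s t) := by
    refine eVariationOn_le_of_edist_le fun x hx y hy => ?_
    rw [edist_dist, edist_dist, edist_dist, ← ENNReal.ofReal_mul (by positivity),
      ← ENNReal.ofReal_mul hR0, ← ENNReal.ofReal_add (by positivity) (by positivity)]
    refine ENNReal.ofReal_le_ofReal ?_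
    rw [dist_eq_norm, dist_eq_norm, dist_eq_norm]
    have e : D (φ x) (φ' x) - D (φ y) (φ' y) =
        (D (φ x) - D (φ y)) (φ' x) + D (φ y) (φ' x - φ' y) := by
      simp
    rw [e]
    refine (norm_add_le _ _).trans (add_le_add ?_ ?_)
    · refine ((D (φ x) - D (φ y)).le_opNorm _).trans ?_
      calc _ ≤ (6 * C * (M * |x - y|)) * M := by
            gcongr
            · refine (hf.norm_sub_le hC (φ y) (φ x)).trans ?_
              gcongr
              exact hLip x hx y hy
            · exact hM x hx
        _ = _ := by rw [Real.norm_eq_abs]; ring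
    · exact ((D (φ y)).le_opNorm _).trans (by gcongr; exact hR y hy)
  refine ne_top_of_le_ne_top ?_ hvar
  have hid : eVariationOn (fun x : ℝ => x) (Icc s t) ≠ ∞ := by
    have := (monotone_id.monotoneOn (Icc s t)).eVariationOn_eq (left_mem_Icc.2 hst)
      (right_mem_Icc.2 hst)
    rw [inter_self] at this
    exact this ▸ ENNReal.ofReal_ne_top
  exact ENNReal.add_ne_top.2 ⟨ENNReal.mul_ne_top ENNReal.ofReal_ne_top hid,
    ENNReal.mul_ne_top ENNReal.ofReal_ne_top hbv'⟩

/-! ### Bumps with quadratic approximation on 2-smooth spaces -/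

section Bump

variable {E : Type*} [NormedAddCommGroup E] [NormedSpace ℝ E]

/-- A norming functional `g` of `x` gives the lower bound `‖x‖ ^ 2 + 2 * ‖x‖ * g h ≤ ‖x + h‖ ^ 2`.
The same bound at `-h`, inserted in the 2-smoothness inequality, gives the upper bound. -/
theorem exists_quadApprox_norm_sq {K : ℝ}
    (hE : ∀ x h : E, ‖x + h‖ ^ 2 + ‖x - h‖ ^ 2 ≤ 2 * ‖x‖ ^ 2 + 2 * K * ‖h‖ ^ 2) :
    ∃ D : E → E →L[ℝ] ℝ, QuadApprox (2 * K) (fun x => ‖x‖ ^ 2) D ∧ ∀ x h, |D x h| ≤ 2 * ‖x‖ * ‖h‖ := by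
  choose g hg hgx using fun x : E => exists_dual_vector'' ℝ x
  have hgle : ∀ x h, |g x h| ≤ ‖h‖ := fun x h => by
    simpa using (g x).le_of_opNorm_le (hg x) h
  have hlow : ∀ x h, ‖x‖ ^ 2 + 2 * ‖x‖ * g x h ≤ ‖x + h‖ ^ 2 := fun x h => by
    have := sq_le_sq' (neg_le_of_abs_le (hgle x (x + h))) (le_of_abs_le (hgle x (x + h)))
    rw [map_add, hgx] at this
    simp only [RCLike.ofReal_real_eq_id, id] at this
    nlinarith [sq_nonneg (g x h)]
  refine ⟨fun x => (2 * ‖x‖) • g x, fun x h => ?_, fun x h => ?_⟩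
  · have h₁ := hlow x h
    have h₂ := hlow x (-h)
    have h₃ := hE x h
    rw [map_neg, ← sub_eq_add_neg] at h₂
    simp only [_root_.smul_apply, smul_eq_mul]
    rw [abs_le]
    constructor <;> nlinarith
  · simp only [_root_.smul_apply, smul_eq_mul, abs_mul, abs_two, abs_norm]
    gcongr
    exact hgle x h

/-- The bump is `max 0 (1 - ‖x‖ ^ 2) ^ 2`; squaring removes the kink at the unit sphere and makes
the derivative vanish wherever the bump does. -/
theorem exists_bump {K : ℝ} (hK : 0 ≤ K)
    (hE : ∀ x h : E, ‖x + h‖ ^ 2 + ‖x - h‖ ^ 2 ≤ 2 * ‖x‖ ^ 2 + 2 * K * ‖h‖ ^ 2) :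
    ∃ (C : ℝ) (β : E → ℝ) (D : E → E →L[ℝ] ℝ), 0 ≤ C ∧ QuadApprox C β D ∧ β 0 = 1 ∧
      (∀ x, β x = 0 → D x = 0) ∧ ∀ x, 1 ≤ ‖x‖ → β x = 0 := by
  obtain ⟨D, hD, hDle⟩ := exists_quadApprox_norm_sq hE
  set θ : E → ℝ := fun x => max 0 (1 - ‖x‖ ^ 2) with hθ
  have hθ0 : ∀ x, 0 ≤ θ x := fun x => le_max_left _ _
  have hθ1 : ∀ x, θ x ≤ 1 := fun x => max_le zero_le_one (by nlinarith [norm_nonneg x])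
  have hθz : ∀ x, 1 ≤ ‖x‖ → θ x = 0 := fun x hx => max_eq_left (by nlinarith)
  have hθD : ∀ x h, |θ x * D x h| ≤ 2 * ‖h‖ := fun x h => by
    rcases le_total 1 ‖x‖ with hx | hx
    · simp [hθz x hx]
    · rw [abs_mul, abs_of_nonneg (hθ0 x)]
      calc _ ≤ 1 * (2 * 1 * ‖h‖) := by
            gcongr
            · exact hθ1 x
            · exact (hDle x h).trans (by gcongr)
        _ = _ := by ring
  -- For `‖h‖ ≤ 1`, `‖x‖ ≤ 2`, the square of the increment of `‖·‖ ^ 2` contributes `25` and its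
  -- linearization error `4 * K`. For `‖h‖ > 1` the error is at most `1 + 4 * ‖h‖`.
  refine ⟨25 + 4 * K, fun x => θ x ^ 2, fun x => (-2 * θ x) • D x, by positivity, fun x h => ?_,
    by simp [hθ], fun x hx => by simp [pow_eq_zero_iff (two_ne_zero)] at hx; simp [hx],
    fun x hx => by simp [hθz x hx]⟩
  have hKh : 0 ≤ K * ‖h‖ ^ 2 := by positivity
  simp only [_root_.smul_apply, smul_eq_mul]
  rcases le_or_gt ‖h‖ 1 with hh | hh
  · rcases le_or_gt ‖x‖ 2 with hx | hx
    · have h₁ := hD x h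
      simp only at h₁
      set r := ‖x + h‖ ^ 2 - ‖x‖ ^ 2 with hr
      -- Taylor bound for `a ↦ max 0 a ^ 2`, whose derivative `2 * max 0 a` is 2-Lipschitz.
      have h₂ : |θ (x + h) ^ 2 - θ x ^ 2 + 2 * θ x * r| ≤ r ^ 2 := by
        simp only [hθ]
        rw [abs_le]
        rcases max_cases 0 (1 - ‖x‖ ^ 2) with ⟨e₁, e₁'⟩ | ⟨e₁, e₁'⟩ <;>
        rcases max_cases 0 (1 - ‖x + h‖ ^ 2) with ⟨e₂, e₂'⟩ | ⟨e₂, e₂'⟩ <;>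
        rw [e₁, e₂] <;> constructor <;> nlinarith
      have h₃ : r ^ 2 ≤ 25 * ‖h‖ ^ 2 := by
        have t₁ : |‖x + h‖ - ‖x‖| ≤ ‖h‖ := by simpa using abs_norm_sub_norm_le (x + h) x
        have t₂ : |‖x + h‖ + ‖x‖| ≤ 5 := by
          rw [abs_of_nonneg (by positivity)]
          linarith [norm_add_le x h]
        have t₃ : |r| ≤ 5 * ‖h‖ := by
          rw [hr, sq_sub_sq, abs_mul]
          gcongr
        calc r ^ 2 = |r| ^ 2 := (sq_abs r).symm
          _ ≤ (5 * ‖h‖) ^ 2 := by gcongr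
          _ = _ := by ring
      have h₄ : |2 * θ x * (r - D x h)| ≤ 4 * (K * ‖h‖ ^ 2) := by
        rw [abs_mul, abs_of_nonneg (by linarith [hθ0 x])]
        calc _ ≤ 2 * 1 * (2 * K * ‖h‖ ^ 2) := by
              gcongr
              exact hθ1 x
          _ = _ := by ring
      rw [abs_le] at *
      constructor <;> linarith
    · have : 1 ≤ ‖x + h‖ := by
        have := norm_sub_norm_le x (-h)
        rw [norm_neg, sub_neg_eq_add] at this
        linarith
      rw [hθz x (by linarith), hθz _ this]
      simp
      positivity
  · have h₁ : |θ (x + h) ^ 2 - θ x ^ 2| ≤ 1 := by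
      rw [abs_le]
      constructor <;> nlinarith [hθ0 x, hθ1 x, hθ0 (x + h), hθ1 (x + h)]
    have h₂ := hθD x h
    rw [abs_le] at *
    constructor <;> nlinarith

theorem QuadApprox.rescale {C : ℝ} {f : E → ℝ} {D : E → E →L[ℝ] ℝ} (hf : QuadApprox C f D) {s : ℝ}
    (hs : 0 ≤ s) (c : ℝ) (d : E) :
    QuadApprox (s * c ^ 2 * C) (fun x => s * f (c • (x - d)))
      (fun x => (s * c) • D (c • (x - d))) := by
  intro x h
  have := hf (c • (x - d)) (c • h)
  rw [← smul_add, norm_smul, mul_pow, Real.norm_eq_abs, sq_abs, map_smul] at this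
  simp only [_root_.smul_apply, smul_eq_mul] at this ⊢
  rw [show x + h - d = x - d + h by abel]
  calc _ = s * |f (c • (x - d + h)) - f (c • (x - d)) - c * D (c • (x - d)) h| := by
        rw [← abs_of_nonneg hs, ← abs_mul, abs_of_nonneg hs]
        ring_nf
    _ ≤ s * (C * (c ^ 2 * ‖h‖ ^ 2)) := by gcongr
    _ = _ := by ring

/-- At most one summand is nonzero at `x` and at most one at `x + h`, so at most two errors are
added, whence the factor `2`. -/
theorem QuadApprox.tsum {ι : Type*} [Nonempty ι] {C : ℝ} (hC : 0 ≤ C) {F : ι → E → ℝ}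
    {D : ι → E → E →L[ℝ] ℝ} (hF : ∀ i, QuadApprox C (F i) (D i))
    (hD : ∀ i x, F i x = 0 → D i x = 0) (hdisj : ∀ i j x, i ≠ j → F i x = 0 ∨ F j x = 0) :
    QuadApprox (2 * C) (fun x => ∑' i, F i x) (fun x => ∑' i, D i x) := by
  have hsupp : ∀ x, ∃ i, ∀ j, j ≠ i → F j x = 0 := fun x => by
    by_cases h : ∃ i, F i x ≠ 0
    · obtain ⟨i, hi⟩ := h
      exact ⟨i, fun j hj => (hdisj j i x hj).resolve_right hi⟩
    · push Not at h
      exact ⟨Classical.arbitrary ι, fun j _ => h j⟩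
  intro x h
  obtain ⟨i, hi⟩ := hsupp x
  obtain ⟨j, hj⟩ := hsupp (x + h)
  have hn : 0 ≤ C * ‖h‖ ^ 2 := by positivity
  simp only
  rw [tsum_eq_single i hi, tsum_eq_single j hj, tsum_eq_single i fun k hk => hD k x (hi k hk)]
  have h₁ := hF i x h
  rcases eq_or_ne i j with rfl | hij
  · linarith
  have h₂ := hF j x h
  rw [hi j hij.symm, hD j x (hi j hij.symm)] at h₂
  rw [hj i hij] at h₁
  simp only [_root_.zero_apply] at h₂
  rw [abs_le] at *
  constructor <;> linarith

end Bump

/-! ### Dyadic nodes -/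

section Node

variable {E : Type*} [NormedAddCommGroup E] [NormedSpace ℝ E]

/-- The sign `1` or `-1` coded by a Boolean. -/
def boolSign (b : Bool) : ℝ := if b then 1 else -1

/-- The sign of the `i`-th letter of `w`, counted from the end; zero beyond the length of `w`. -/
def signCoeff (w : List Bool) (i : ℕ) : ℝ := (w.reverse[i]?).elim 0 boolSign

/-- The vertex `∑ i, ± ε • e i` of a cube coded by a list of signs. -/
def cubeNode (e : ℕ → E) (ε : ℝ) : List Bool → E
  | [] => 0
  | b :: w => cubeNode e ε w + (boolSign b * ε) • e w.length

theorem abs_boolSign (b : Bool) : |boolSign b| = 1 := by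
  cases b <;> simp [boolSign]

theorem signCoeff_cons (b : Bool) (w : List Bool) (i : ℕ) :
    signCoeff (b :: w) i = signCoeff w i + if i = w.length then boolSign b else 0 := by
  simp only [signCoeff, List.reverse_cons, List.getElem?_append, List.length_reverse]
  rcases lt_trichotomy i w.length with h | h | h
  · simp [h, h.ne]
  · simp [h]
  · have : 1 ≤ i - w.length := by omega
    simp [h.ne', not_lt.2 h.le, List.getElem?_eq_none, this]

theorem one_le_abs_signCoeff {w : List Bool} {i : ℕ} (h : i < w.length) :
    1 ≤ |signCoeff w i| := by
  simp [signCoeff, h, abs_boolSign]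

theorem exists_one_le_abs_signCoeff_sub {w w' : List Bool} (h : w ≠ w') :
    ∃ i, 1 ≤ |signCoeff w i - signCoeff w' i| := by
  by_contra! H
  refine h (List.reverse_injective (List.ext_getElem? fun i => ?_))
  have := H i
  simp only [signCoeff] at this
  revert this
  rcases w.reverse[i]? with _ | _ | _ <;> rcases w'.reverse[i]? with _ | _ | _ <;>
    simp [boolSign] <;> norm_num

variable {e : ℕ × ℕ → E} {l : ℕ × ℕ → E →L[ℝ] ℝ}

theorem apply_cubeNode (hle : ∀ i j, l i (e j) = if i = j then 1 else 0) (ε : ℝ) (k m i : ℕ)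
    (w : List Bool) :
    l (k, i) (cubeNode (fun j => e (m, j)) ε w) = if k = m then signCoeff w i * ε else 0 := by
  induction w with
  | nil => simp [cubeNode, signCoeff]
  | cons b w ih =>
    rw [cubeNode, map_add, ih, map_smul, hle, signCoeff_cons]
    by_cases hk : k = m <;> by_cases hi : i = w.length <;> simp [hk, hi, add_mul]

/-- Some coordinate functional tells the nodes apart. In one cube, it is a letter where the words
differ, a missing letter counting as `0`. Across cubes, coordinate `(m', 0)` is `± ε m'` at the
second node, as `w'` is nonempty, and `0` at the first. -/
theorem le_norm_cubeNode_sub (hl : ∀ i x, |l i x| ≤ ‖x‖)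
    (hle : ∀ i j, l i (e j) = if i = j then 1 else 0) {ε : ℕ → ℝ} (hε : ∀ m, 0 < ε m) {m m' : ℕ}
    {w w' : List Bool} (hw' : w' ≠ []) (hne : (m, w) ≠ (m', w')) :
    ε m' ≤ ‖cubeNode (fun j => e (m, j)) (ε m) w - cubeNode (fun j => e (m', j)) (ε m') w'‖ := by
  by_cases hm : m = m'
  · subst hm
    obtain ⟨i, hi⟩ := exists_one_le_abs_signCoeff_sub (w := w) (w' := w') fun h => hne (by rw [h])
    refine le_trans ?_ (hl (m, i) _)
    rw [map_sub, apply_cubeNode hle, apply_cubeNode hle, if_pos rfl, if_pos rfl, ← sub_mul, abs_mul,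
      abs_of_pos (hε m)]
    exact le_mul_of_one_le_left (hε m).le hi
  · refine le_trans ?_ (hl (m', 0) _)
    rw [map_sub, apply_cubeNode hle, apply_cubeNode hle, if_pos rfl, if_neg (Ne.symm hm), zero_sub,
      abs_neg, abs_mul, abs_of_pos (hε m')]
    exact le_mul_of_one_le_left (hε m').le
      (one_le_abs_signCoeff (List.length_pos_of_ne_nil hw'))

/-- A bump of height `ε ^ 2` and radius `ε / 4` has an approximation constant independent of `ε`.
Odd words are nonempty, so the separation of nodes makes the supports disjoint and keeps them off
all other nodes. -/
theorem exists_quadApprox_cubeNode {K : ℝ} (hK : 0 ≤ K)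
    (hE : ∀ x h : E, ‖x + h‖ ^ 2 + ‖x - h‖ ^ 2 ≤ 2 * ‖x‖ ^ 2 + 2 * K * ‖h‖ ^ 2)
    (hl : ∀ i x, |l i x| ≤ ‖x‖) (hle : ∀ i j, l i (e j) = if i = j then 1 else 0)
    {ε : ℕ → ℝ} (hε : ∀ m, 0 < ε m) :
    ∃ (C : ℝ) (f : E → ℝ) (D : E → E →L[ℝ] ℝ), 0 ≤ C ∧ QuadApprox C f D ∧
      ∀ m w, f (cubeNode (fun j => e (m, j)) (ε m) w) = if Odd w.length then ε m ^ 2 else 0 := by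
  obtain ⟨C, β, D, hC, hβ, hβ0, hβD, hβs⟩ := exists_bump hK hE
  let ι := {i : ℕ × List Bool // Odd i.2.length}
  have : Nonempty ι := ⟨⟨(0, [true]), by simp⟩⟩
  let d : ℕ → List Bool → E := fun m w => cubeNode (fun j => e (m, j)) (ε m) w
  let F : ι → E → ℝ := fun i x => ε i.1.1 ^ 2 * β ((4 / ε i.1.1) • (x - d i.1.1 i.1.2))
  let G : ι → E → E →L[ℝ] ℝ := fun i x =>
    (ε i.1.1 ^ 2 * (4 / ε i.1.1)) • D ((4 / ε i.1.1) • (x - d i.1.1 i.1.2))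
  have hF : ∀ i, QuadApprox (16 * C) (F i) (G i) := fun i => by
    have := hβ.rescale (sq_nonneg (ε i.1.1)) (4 / ε i.1.1) (d i.1.1 i.1.2)
    have h0 := (hε i.1.1).ne'
    rwa [show ε i.1.1 ^ 2 * (4 / ε i.1.1) ^ 2 = 16 by field_simp; norm_num] at this
  have hsupp : ∀ (i : ι) x, ε i.1.1 / 4 ≤ ‖x - d i.1.1 i.1.2‖ → F i x = 0 := fun i x hx => by
    have h0 := hε i.1.1
    simp only [F]
    rw [hβs, mul_zero]
    rw [norm_smul, Real.norm_eq_abs, abs_of_pos (by positivity)]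
    calc (1 : ℝ) = 4 / ε i.1.1 * (ε i.1.1 / 4) := by field_simp
      _ ≤ _ := by gcongr
  have hne : ∀ i : ι, i.1.2 ≠ [] := fun i h => by
    have := i.2
    simp [h] at this
  have hsep : ∀ (m : ℕ) (w : List Bool) (i : ι), (m, w) ≠ i.1 →
      ε i.1.1 ≤ ‖d m w - d i.1.1 i.1.2‖ := fun m w i hi => by
    exact le_norm_cubeNode_sub hl hle hε (hne i) hi
  refine ⟨2 * (16 * C), fun x => ∑' i, F i x, fun x => ∑' i, G i x, by positivity,
    QuadApprox.tsum (by positivity) hF (fun i x hx => ?_) (fun i j x hij => ?_), fun m w => ?_⟩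
  · have h0 := hε i.1.1
    simp only [F, mul_eq_zero, pow_eq_zero_iff two_ne_zero, h0.ne', false_or] at hx
    simp [G, hβD _ hx]
  · by_contra! H
    have h₁ := not_le.1 (mt (hsupp i x) H.1)
    have h₂ := not_le.1 (mt (hsupp j x) H.2)
    have h₃ := hsep i.1.1 i.1.2 j fun h => hij (Subtype.ext h)
    have h₄ := hsep j.1.1 j.1.2 i fun h => hij (Subtype.ext h.symm)
    rw [norm_sub_rev] at h₄
    have h₅ := norm_sub_le_norm_sub_add_norm_sub (d i.1.1 i.1.2) x (d j.1.1 j.1.2)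
    rw [norm_sub_rev (d i.1.1 i.1.2) x] at h₅
    linarith [hε i.1.1, hε j.1.1]
  · have hz : ∀ i : ι, (m, w) ≠ i.1 → F i (d m w) = 0 := fun i hi => by
      refine hsupp i _ (le_trans ?_ (hsep m w i hi))
      linarith [hε i.1.1]
    simp only
    split_ifs with hw
    · rw [tsum_eq_single ⟨(m, w), hw⟩ fun i hi => hz i fun h => hi (Subtype.ext h.symm)]
      simp [F, d, hβ0]
    · exact (tsum_congr fun i => hz i fun h => hw (by simpa [← h] using i.2)).trans tsum_zero

/-- Children have the opposite parity to their parent, so the second difference is `± 2 * ε ^ 2` at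
every node. -/
theorem hasTree_cubeNode {f : E → ℝ} {e : ℕ → E} {ε r : ℝ} {N : ℕ}
    (hf : ∀ w, f (cubeNode e ε w) = if Odd w.length then ε ^ 2 else 0)
    (hr : ∀ w : List Bool, w.length ≤ N → ‖cubeNode e ε w‖ < r) :
    ∀ (n : ℕ) (w : List Bool), w.length + n = N →
      HasTree f (Metric.ball 0 r) (2 * ε ^ 2) n (cubeNode e ε w)
  | 0, w, h => by simpa [HasTree] using hr w (by omega)
  | n + 1, w, h => by
    have h₁ : cubeNode e ε w + ε • e w.length = cubeNode e ε (true :: w) := by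
      simp [cubeNode, boolSign]
    have h₂ : cubeNode e ε w - ε • e w.length = cubeNode e ε (false :: w) := by
      simp [cubeNode, boolSign, sub_eq_add_neg]
    refine ⟨by simpa using hr w (by omega), ε • e w.length, ?_, ?_, ?_⟩
    · rw [h₁, h₂, hf, hf, hf]
      by_cases hw : Odd w.length
      · have : ¬ Odd (w.length + 1) := by simpa [Nat.odd_add_one] using hw
        simp [hw, this]
      · have : Odd (w.length + 1) := by simpa [Nat.odd_add_one] using hw
        simp only [List.length_cons, this, hw, if_true, if_false]
        rw [mul_zero, sub_zero, abs_of_nonneg (by positivity)]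
        linarith
    · rw [h₁]
      exact hasTree_cubeNode hf hr n _ (by simp; omega)
    · rw [h₂]
      exact hasTree_cubeNode hf hr n _ (by simp; omega)

/-- With `ε = r / 2 * N ^ (-1 / q)`, the sum `N * ε ^ q` is fixed at `(r / 2) ^ q`, while `N * ε ^
2` grows like `N ^ (1 - 2 / q)`. This is where `q > 2` is essential. -/
theorem exists_natCast_mul_rpow_lt {q r K : ℝ} (hq : 2 < q) (hr : 0 < r) :
    ∃ (N : ℕ) (ε : ℝ), 0 < ε ∧ N * ε ^ q < r ^ q ∧ K < N * ε ^ 2 := by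
  have ht : Filter.Tendsto (fun N : ℕ => (r / 2) ^ 2 * (N : ℝ) ^ (1 - 2 / q)) Filter.atTop
      Filter.atTop := by
    refine Filter.Tendsto.const_mul_atTop (by positivity) ?_
    refine (tendsto_rpow_atTop ?_).comp tendsto_natCast_atTop_atTop
    rw [sub_pos, div_lt_one (by linarith)]
    exact hq
  obtain ⟨N, hN, hN1⟩ := ((ht.eventually_gt_atTop K).and (Filter.eventually_ge_atTop 1)).exists
  have hN0 : (0 : ℝ) < N := by exact_mod_cast hN1
  refine ⟨N, r / 2 * (N : ℝ) ^ (-(1 / q)), by positivity, ?_, ?_⟩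
  · rw [Real.mul_rpow (by positivity) (by positivity), ← Real.rpow_mul hN0.le,
      show -(1 / q) * q = -1 by field_simp, Real.rpow_neg_one]
    rw [mul_left_comm, mul_inv_cancel₀ hN0.ne', mul_one]
    exact Real.rpow_lt_rpow (by positivity) (by linarith) (by linarith)
  · refine hN.trans_eq ?_
    rw [mul_pow, ← Real.rpow_natCast ((N : ℝ) ^ (-(1 / q))) 2, ← Real.rpow_mul hN0.le,
      Real.rpow_sub hN0, Real.rpow_one, show -(1 / q) * ((2 : ℕ) : ℝ) = -(2 / q) by push_cast; ring,
      Real.rpow_neg hN0.le]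
    field_simp

theorem exists_not_deltaConvexOn_of_two_smooth {K q : ℝ} (hK : 0 ≤ K) (hq : 2 < q)
    (hE : ∀ x h : E, ‖x + h‖ ^ 2 + ‖x - h‖ ^ 2 ≤ 2 * ‖x‖ ^ 2 + 2 * K * ‖h‖ ^ 2)
    (hl : ∀ i x, |l i x| ≤ ‖x‖) (hle : ∀ i j, l i (e j) = if i = j then 1 else 0)
    (hnorm : ∀ (m : ℕ) (ε : ℝ) (w : List Bool), 0 < ε →
      ‖cubeNode (fun j => e (m, j)) ε w‖ ^ q ≤ w.length * ε ^ q) :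
    ∃ (C : ℝ) (f : E → ℝ) (D : E → E →L[ℝ] ℝ), 0 ≤ C ∧ QuadApprox C f D ∧
      ∀ U ∈ 𝓝 (0 : E), ¬ DeltaConvexOn U f := by
  -- The `m`-th tree lies in the ball of radius `1 / (m + 1)` and has `N m * ε m ^ 2 > m`, so one
  -- `f` serves all balls.
  choose N ε hε h₁ h₂ using fun m : ℕ =>
    exists_natCast_mul_rpow_lt (q := q) (r := 1 / ((m : ℝ) + 1)) (K := m) hq (by positivity)
  obtain ⟨C, f, D, hC, hf, hfn⟩ := exists_quadApprox_cubeNode hK hE hl hle hε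
  refine ⟨C, f, D, hC, hf, fun U hU => not_deltaConvexOn_of_hasTree (fun r hr M => ?_) hU⟩
  obtain ⟨m₁, hm₁⟩ := exists_nat_one_div_lt hr
  obtain ⟨m₂, hm₂⟩ := exists_nat_gt M
  set m := max m₁ m₂
  have hmr : 1 / ((m : ℝ) + 1) < r :=
    (Nat.one_div_le_one_div (le_max_left m₁ m₂)).trans_lt hm₁
  have hmM : M < m := hm₂.trans_le (by exact_mod_cast le_max_right m₁ m₂)
  refine ⟨N m, 2 * ε m ^ 2, cubeNode (fun j => e (m, j)) (ε m) [], ?_,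
    hasTree_cubeNode (N := N m) (hfn m) (fun w hw => ?_) _ _ (by simp)⟩
  · have := h₂ m
    have : 0 ≤ N m * ε m ^ 2 := by positivity
    nlinarith
  · refine lt_trans (lt_of_not_ge fun hge => ?_) hmr
    have t₁ := hnorm m (ε m) w (hε m)
    have t₂ : (w.length : ℝ) * ε m ^ q ≤ N m * ε m ^ q := by
      have := (hε m).le
      gcongr
    have t₃ := Real.rpow_le_rpow (z := q) (by positivity) hge (by linarith)
    linarith [h₁ m]

end Node

/-! ### A quadratic form on `ℓ¹` -/

section QuadraticForm

/-- A matrix of signs indexed by Boolean words: the sign is determined by the parity of the length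
of the longest common suffix of the part of the words that is compared. -/
def suffixSign : List Bool → List Bool → ℝ
  | b :: u, c :: v => if b :: u = c :: v then -suffixSign u v else suffixSign u v
  | _, _ => 1

theorem abs_suffixSign : ∀ u v : List Bool, |suffixSign u v| = 1
  | [], _ => by simp [suffixSign]
  | _ :: _, [] => by simp [suffixSign]
  | b :: u, c :: v => by
    rw [suffixSign]
    split_ifs <;> simp [abs_suffixSign u v]

theorem suffixSign_cons_of_ne {b c : Bool} {u v : List Bool} (h : b :: u ≠ c :: v) :
    suffixSign (b :: u) (c :: v) = suffixSign u v := by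
  rw [suffixSign, if_neg h]

theorem suffixSign_self (u : List Bool) : suffixSign u u = (-1) ^ u.length := by
  induction u with
  | nil => simp [suffixSign]
  | cons b u ih => rw [suffixSign, if_pos rfl, ih, List.length_cons, pow_succ]; ring

variable {E : Type*} [NormedAddCommGroup E] [NormedSpace ℝ E]

/-- The average of the vectors `e v` over the words `v` that extend `u` by `n` letters. -/
noncomputable def wordAverage (e : List Bool → E) : ℕ → List Bool → E
  | 0, u => e u
  | n + 1, u =>
    (1 / 2 : ℝ) • (wordAverage e n (true :: u) + wordAverage e n (false :: u))

theorem norm_wordAverage_le {e : List Bool → E} (he : ∀ u, ‖e u‖ ≤ 1) :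
    ∀ n u, ‖wordAverage e n u‖ ≤ 1
  | 0, u => he u
  | n + 1, u => by
    rw [wordAverage, norm_smul]
    have := norm_add_le (wordAverage e n (true :: u)) (wordAverage e n (false :: u))
    have := norm_wordAverage_le he n (true :: u)
    have := norm_wordAverage_le he n (false :: u)
    norm_num
    linarith

variable {e : List Bool → E} {B : E →L[ℝ] E →L[ℝ] ℝ}

/-- Words grow at the front, so extending two distinct words of equal length leaves their common
suffix, hence the sign, unchanged. All entries being averaged are equal. -/
theorem apply_wordAverage_of_ne (hB : ∀ u v, B (e u) (e v) = suffixSign u v) :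
    ∀ (n : ℕ) (u v : List Bool), u ≠ v → u.length = v.length →
      B (wordAverage e n u) (wordAverage e n v) = suffixSign u v
  | 0, u, v, _, _ => hB u v
  | n + 1, u, v, h, hl => by
    have key : ∀ b c : Bool, B (wordAverage e n (b :: u)) (wordAverage e n (c :: v)) =
        suffixSign u v := fun b c => by
      have hne : b :: u ≠ c :: v := fun H => h (List.cons.inj H).2
      rw [apply_wordAverage_of_ne hB n _ _ hne (by simp [hl]), suffixSign_cons_of_ne hne]
    simp only [wordAverage, map_smul, map_add, _root_.smul_apply, _root_.add_apply, key, smul_eq_mul]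
    ring

theorem apply_wordAverage_siblings (hB : ∀ u v, B (e u) (e v) = suffixSign u v) (n : ℕ)
    (u : List Bool) {b c : Bool} (hbc : b ≠ c) :
    B (wordAverage e n (b :: u)) (wordAverage e n (c :: u)) = (-1) ^ u.length := by
  have hne : b :: u ≠ c :: u := fun H => hbc (List.cons.inj H).1
  rw [apply_wordAverage_of_ne hB n _ _ hne (by simp), suffixSign_cons_of_ne hne, suffixSign_self]

theorem exists_apply_wordAverage_self (hB : ∀ u v, B (e u) (e v) = suffixSign u v) :
    ∀ n : ℕ, ∃ c : ℝ, 0 ≤ c ∧ c ≤ 1 ∧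
      ∀ u, B (wordAverage e n u) (wordAverage e n u) = (-1) ^ u.length * c
  | 0 => ⟨1, zero_le_one, le_rfl, fun u => by rw [wordAverage, hB, suffixSign_self, mul_one]⟩
  | n + 1 => by
    obtain ⟨c, h0, h1, hc⟩ := exists_apply_wordAverage_self hB n
    -- The two diagonal terms carry the sign of the next level and the two sibling terms that of
    -- `u`, giving `c ↦ (1 - c) / 2`.
    refine ⟨(1 - c) / 2, by linarith, by linarith, fun u => ?_⟩
    simp only [wordAverage, map_smul, map_add, _root_.smul_apply, _root_.add_apply, hc, smul_eq_mul,
      apply_wordAverage_siblings hB n u (b := true) (c := false) (by simp),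
      apply_wordAverage_siblings hB n u (b := false) (c := true) (by simp), List.length_cons,
      pow_succ]
    ring

/-- Siblings `y`, `z` have diagonal values of sign opposite to `B y z`, so nothing cancels in `B (y
- z) (y - z)`. The second difference has size `s ^ 2 * (1 + c) ≥ s ^ 2` at every depth. -/
theorem hasTree_wordAverage (hB : ∀ u v, B (e u) (e v) = suffixSign u v) (he : ∀ u, ‖e u‖ ≤ 1)
    {r s : ℝ} (hs : 0 < s) (hsr : s < r) : ∀ (n : ℕ) (u : List Bool),
      HasTree (fun x => B x x) (Metric.ball 0 r) (s ^ 2) n (s • wordAverage e n u) := by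
  have hmem : ∀ n u, s • wordAverage e n u ∈ Metric.ball (0 : E) r := fun n u => by
    rw [mem_ball_zero_iff, norm_smul, Real.norm_eq_abs, abs_of_pos hs]
    nlinarith [norm_wordAverage_le he n u]
  intro n
  induction n with
  | zero => exact fun u => hmem 0 u
  | succ n ih =>
    intro u
    obtain ⟨c, h0, h1, hc⟩ := exists_apply_wordAverage_self hB n
    set y := wordAverage e n (true :: u) with hy
    set z := wordAverage e n (false :: u) with hz
    have e₀ : s • wordAverage e (n + 1) u = (s / 2) • (y + z) := by
      rw [wordAverage, smul_smul, mul_one_div]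
    have e₁ : s • wordAverage e (n + 1) u + (s / 2) • (y - z) = s • y := by
      rw [e₀, ← smul_add, show y + z + (y - z) = (2 : ℝ) • y by rw [two_smul]; abel, smul_smul]
      congr 1
      ring
    have e₂ : s • wordAverage e (n + 1) u - (s / 2) • (y - z) = s • z := by
      rw [e₀, ← smul_sub, show y + z - (y - z) = (2 : ℝ) • z by rw [two_smul]; abel, smul_smul]
      congr 1
      ring
    refine ⟨hmem _ _, (s / 2) • (y - z), ?_, e₁ ▸ ih _, e₂ ▸ ih _⟩
    have hyz : B y z = (-1) ^ u.length := apply_wordAverage_siblings hB n u (by simp)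
    have hzy : B z y = (-1) ^ u.length := apply_wordAverage_siblings hB n u (by simp)
    have hyy : B y y = -((-1) ^ u.length * c) := by
      rw [hy, hc, List.length_cons, pow_succ]; ring
    have hzz : B z z = -((-1) ^ u.length * c) := by
      rw [hz, hc, List.length_cons, pow_succ]; ring
    rw [e₁, e₂, e₀]
    simp only [map_smul, map_add, _root_.smul_apply, _root_.add_apply, smul_eq_mul, hyy, hzz, hyz,
      hzy]
    have habs : |((-1 : ℝ)) ^ u.length| = 1 := by simp
    calc s ^ 2 ≤ s ^ 2 * (1 + c) := le_mul_of_one_le_right (sq_nonneg s) (by linarith)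
      _ = |-((-1) ^ u.length * (s ^ 2 * (1 + c)))| := by
        rw [abs_neg, abs_mul, habs, one_mul, abs_of_nonneg (by positivity)]
      _ = _ := by
        congr 1
        ring

theorem quadApprox_bilin (B : E →L[ℝ] E →L[ℝ] ℝ) :
    QuadApprox ‖B‖ (fun x => B x x) (fun x => B x + B.flip x) := by
  intro x h
  have : B (x + h) (x + h) - B x x - (B x + B.flip x) h = B h h := by
    simp only [map_add, _root_.add_apply, ContinuousLinearMap.flip_apply]
    ring
  simp only
  rw [this, sq, ← mul_assoc]
  exact B.le_opNorm₂ h h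

/-- Any bounded matrix acts on absolutely summable coefficients: the double series is dominated by
the product of the two `ℓ¹` sums. -/
theorem exists_bilin_suffixSign {l : List Bool → E →L[ℝ] ℝ}
    (hle : ∀ u v, l u (e v) = if u = v then 1 else 0) (hsum : ∀ x, Summable fun u => |l u x|)
    (hnorm : ∀ x, ∑' u, |l u x| ≤ ‖x‖) :
    ∃ B : E →L[ℝ] E →L[ℝ] ℝ, ∀ u v, B (e u) (e v) = suffixSign u v := by
  let F : E → E → List Bool × List Bool → ℝ :=
    fun x y z => suffixSign z.1 z.2 * (l z.1 x * l z.2 y)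
  have hFabs : ∀ x y z, |F x y z| = |l z.1 x| * |l z.2 y| := fun x y z => by
    simp only [F, abs_mul, abs_suffixSign, one_mul]
  have hprod : ∀ x y, Summable fun z : List Bool × List Bool => |l z.1 x| * |l z.2 y| := fun x y =>
    (hsum x).mul_of_nonneg (hsum y) (fun _ => abs_nonneg _) fun _ => abs_nonneg _
  have hF : ∀ x y, Summable (F x y) := fun x y =>
    Summable.of_abs ((hprod x y).congr fun z => (hFabs x y z).symm)
  let L : E →ₗ[ℝ] E →ₗ[ℝ] ℝ := LinearMap.mk₂ ℝ (fun x y => ∑' z, F x y z)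
    (fun x x' y => by
      rw [← (hF x y).tsum_add (hF x' y)]
      exact tsum_congr fun z => by simp only [F, map_add]; ring)
    (fun c x y => by
      rw [smul_eq_mul, ← tsum_mul_left]
      exact tsum_congr fun z => by simp only [F, map_smul, smul_eq_mul]; ring)
    (fun x y y' => by
      rw [← (hF x y).tsum_add (hF x y')]
      exact tsum_congr fun z => by simp only [F, map_add]; ring)
    (fun c x y => by
      rw [smul_eq_mul, ← tsum_mul_left]
      exact tsum_congr fun z => by simp only [F, map_smul, smul_eq_mul]; ring)
  refine ⟨L.mkContinuous₂ 1 fun x y => ?_, fun u v => ?_⟩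
  · have h₁ : ‖∑' z, F x y z‖ ≤ ∑' z : List Bool × List Bool, |l z.1 x| * |l z.2 y| :=
      tsum_of_norm_bounded (hprod x y).hasSum fun z => (hFabs x y z).le
    rw [← (hsum x).tsum_mul_tsum (hsum y) (hprod x y)] at h₁
    rw [one_mul]
    exact h₁.trans (mul_le_mul (hnorm x) (hnorm y) (tsum_nonneg fun _ => abs_nonneg _)
      (norm_nonneg x))
  · change ∑' z, F (e u) (e v) z = _
    rw [tsum_eq_single (u, v)]
    · simp [F, hle]
    · rintro ⟨u', v'⟩ hne
      simp only [F, hle]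
      by_cases h₁ : u' = u
      · by_cases h₂ : v' = v
        · exact absurd (by rw [h₁, h₂]) hne
        · simp [h₂]
      · simp [h₁]

theorem exists_not_deltaConvexOn_of_biorthogonal_l1 {l : List Bool → E →L[ℝ] ℝ}
    (he : ∀ u, ‖e u‖ ≤ 1)
    (hle : ∀ u v, l u (e v) = if u = v then 1 else 0) (hsum : ∀ x, Summable fun u => |l u x|)
    (hnorm : ∀ x, ∑' u, |l u x| ≤ ‖x‖) :
    ∃ (C : ℝ) (f : E → ℝ) (D : E → E →L[ℝ] ℝ), 0 ≤ C ∧ QuadApprox C f D ∧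
      ∀ U ∈ 𝓝 (0 : E), ¬ DeltaConvexOn U f := by
  obtain ⟨B, hB⟩ := exists_bilin_suffixSign hle hsum hnorm
  refine ⟨_, _, _, norm_nonneg B, quadApprox_bilin B, fun U hU =>
    not_deltaConvexOn_of_hasTree (fun r hr K => ?_) hU⟩
  obtain ⟨n, hn⟩ := exists_nat_gt (K / (r / 2) ^ 2)
  rw [div_lt_iff₀ (by positivity)] at hn
  exact ⟨n, _, _, hn, hasTree_wordAverage hB he (half_pos hr) (half_lt_self hr) n []⟩

end QuadraticForm

/-! ### Disjoint sets in infinite-dimensional `Lp` spaces -/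

section DisjointSets

variable {Ω : Type*} [MeasurableSpace Ω] {μ : Measure Ω} {p : ℝ≥0∞}

variable (μ p) in
/-- The span in `Lp` of the indicators of the measurable subsets of `A` of finite measure. -/
def indicatorSpan (A : Set Ω) : Submodule ℝ (Lp ℝ p μ) :=
  Submodule.span ℝ {f | ∃ (B : Set Ω) (hB : MeasurableSet B) (hμB : μ B ≠ ∞), B ⊆ A ∧
    f = indicatorConstLp p hB hμB 1}

theorem indicatorConstLp_congr_ae {B C : Set Ω} (hB : MeasurableSet B) (hμB : μ B ≠ ∞)
    (hC : MeasurableSet C) (hμC : μ C ≠ ∞) (h : B =ᵐ[μ] C) (c : ℝ) :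
    indicatorConstLp p hB hμB c = indicatorConstLp p hC hμC c :=
  MemLp.toLp_congr _ _ (indicator_ae_eq_of_ae_eq_set h)

theorem indicatorConstLp_of_measure_eq_zero {B : Set Ω} (hB : MeasurableSet B) (hμB : μ B = 0)
    (c : ℝ) : indicatorConstLp p hB (hμB ▸ ENNReal.zero_ne_top) c = 0 := by
  rw [indicatorConstLp_congr_ae hB _ MeasurableSet.empty (by simp) (ae_eq_empty.2 hμB),
    indicatorConstLp_empty]

theorem indicatorConstLp_mem_indicatorSpan {A B : Set Ω} (hB : MeasurableSet B) (hμB : μ B ≠ ∞)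
    (hBA : B ⊆ A) : indicatorConstLp p hB hμB (1 : ℝ) ∈ indicatorSpan μ p A :=
  Submodule.subset_span ⟨B, hB, hμB, hBA, rfl⟩

theorem indicatorSpan_mono {A B : Set Ω} (h : A ⊆ B) :
    indicatorSpan μ p A ≤ indicatorSpan μ p B :=
  Submodule.span_mono fun _ ⟨C, hC, hμC, hCA, hf⟩ => ⟨C, hC, hμC, hCA.trans h, hf⟩

theorem indicatorSpan_le_sup {A B : Set Ω} (hB : MeasurableSet B) :
    indicatorSpan μ p A ≤ indicatorSpan μ p B ⊔ indicatorSpan μ p (A \ B) := by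
  refine Submodule.span_le.2 ?_
  rintro _ ⟨C, hC, hμC, hCA, rfl⟩
  have h₁ : μ (C ∩ B) ≠ ∞ := measure_ne_top_of_subset inter_subset_left hμC
  have h₂ : μ (C \ B) ≠ ∞ := measure_ne_top_of_subset sdiff_subset hμC
  have : indicatorConstLp p hC hμC (1 : ℝ) = indicatorConstLp p (hC.inter hB) h₁ 1 +
      indicatorConstLp p (hC.diff hB) h₂ 1 := by
    rw [← indicatorConstLp_disjoint_union (hC.inter hB) (hC.diff hB) h₁ h₂
      disjoint_inf_sdiff]
    congr 1
    exact (inter_union_sdiff C B).symm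
  rw [this]
  exact Submodule.add_mem_sup (indicatorConstLp_mem_indicatorSpan _ _ inter_subset_right)
    (indicatorConstLp_mem_indicatorSpan _ _ (sdiff_subset_sdiff_left hCA))

theorem indicatorConstLp_eq_smul {B : Set Ω} (hB : MeasurableSet B) (hμB : μ B ≠ ∞) (c : ℝ) :
    indicatorConstLp p hB hμB c = c • indicatorConstLp p hB hμB (1 : ℝ) := by
  unfold indicatorConstLp
  rw [← MemLp.toLp_const_smul]
  congr 1
  ext t
  by_cases ht : t ∈ B <;> simp [ht]

/-- Otherwise removing any subset of positive finite measure leaves a finite-dimensional span. Such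
a `B` then has infinite-dimensional span, so it is no atom and splits into two non-null pieces. Each
piece lies in the complement of the other, so both spans are finite-dimensional, a contradiction. -/
theorem exists_subset_not_finiteDimensional_diff {A : Set Ω}
    (hdim : ¬ FiniteDimensional ℝ (indicatorSpan μ p A)) :
    ∃ B ⊆ A, MeasurableSet B ∧ μ B ≠ 0 ∧ μ B ≠ ∞ ∧
      ¬ FiniteDimensional ℝ (indicatorSpan μ p (A \ B)) := by
  have split : ∀ {A B : Set Ω}, MeasurableSet B → ¬ FiniteDimensional ℝ (indicatorSpan μ p A) →
      FiniteDimensional ℝ (indicatorSpan μ p (A \ B)) →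
      ¬ FiniteDimensional ℝ (indicatorSpan μ p B) := fun hB h₁ h₂ h₃ =>
    h₁ (Submodule.finiteDimensional_of_le (indicatorSpan_le_sup hB))
  by_contra! H
  have hex : ∃ B ⊆ A, MeasurableSet B ∧ μ B ≠ 0 ∧ μ B ≠ ∞ := by
    by_contra! h
    refine hdim ?_
    have : indicatorSpan μ p A = ⊥ := by
      refine Submodule.span_eq_bot.2 ?_
      rintro _ ⟨C, hC, hμC, hCA, rfl⟩
      have : μ C = 0 := by_contra fun h0 => hμC (h C hCA hC h0)
      exact indicatorConstLp_of_measure_eq_zero hC this 1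
    rw [this]
    infer_instance
  obtain ⟨B, hBA, hB, hB0, hBt⟩ := hex
  have hBdim := split hB hdim (H B hBA hB hB0 hBt)
  have hex' : ∃ C ⊆ B, MeasurableSet C ∧ μ C ≠ 0 ∧ μ (B \ C) ≠ 0 := by
    by_contra! h
    refine hBdim ?_
    have : indicatorSpan μ p B ≤ Submodule.span ℝ {indicatorConstLp p hB hBt 1} := by
      refine Submodule.span_le.2 ?_
      rintro _ ⟨C, hC, hμC, hCB, rfl⟩
      by_cases hC0 : μ C = 0
      · rw [indicatorConstLp_of_measure_eq_zero hC hC0 1]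
        exact Submodule.zero_mem _
      · have : indicatorConstLp p hC hμC (1 : ℝ) = indicatorConstLp p hB hBt 1 :=
          indicatorConstLp_congr_ae hC hμC hB hBt
            (hCB.eventuallyLE.antisymm (ae_le_set.2 (h C hCB hC hC0))) 1
        rw [this]
        exact Submodule.mem_span_singleton_self _
    exact Submodule.finiteDimensional_of_le this
  obtain ⟨C, hCB, hC, hC0, hBC0⟩ := hex'
  have hCt := measure_ne_top_of_subset hCB hBt
  have hBCt := measure_ne_top_of_subset (sdiff_subset (s := B) (t := C)) hBt
  have h₁ := H C (hCB.trans hBA) hC hC0 hCt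
  have h₂ := H (B \ C) (sdiff_subset.trans hBA) (hB.diff hC) hBC0 hBCt
  refine split hC hBdim ?_ ?_
  · exact Submodule.finiteDimensional_of_le (indicatorSpan_mono (sdiff_subset_sdiff_left hBA))
  · refine Submodule.finiteDimensional_of_le
      (indicatorSpan_mono (B := A \ (B \ C)) fun t ht => ⟨hBA (hCB ht), fun h => h.2 ht⟩)

variable [Fact (1 ≤ p)]

/-- Indicators span a dense subspace as `p ≠ ∞`, and a finite-dimensional subspace is closed. -/
theorem finiteDimensional_of_indicatorSpan_univ (hp : p ≠ ∞)
    [FiniteDimensional ℝ (indicatorSpan μ p univ)] : FiniteDimensional ℝ (Lp ℝ p μ) := by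
  have htop : indicatorSpan μ p univ = ⊤ := by
    refine eq_top_iff.2 fun f _ => ?_
    refine Lp.induction hp (fun f => f ∈ indicatorSpan μ p univ) ?_ ?_ ?_ f
    · intro c s hs hμs
      rw [Lp.simpleFunc.coe_indicatorConst]
      rw [indicatorConstLp_eq_smul]
      exact Submodule.smul_mem _ c (indicatorConstLp_mem_indicatorSpan hs hμs.ne (subset_univ s))
    · exact fun f g hf hg _ h₁ h₂ => Submodule.add_mem _ h₁ h₂
    · exact (indicatorSpan μ p univ).closed_of_finiteDimensional
  have : FiniteDimensional ℝ (⊤ : Submodule ℝ (Lp ℝ p μ)) := htop ▸ inferInstance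
  exact Module.Finite.equiv Submodule.topEquiv

theorem exists_seq_disjoint_of_not_finiteDimensional_Lp (hp : p ≠ ∞)
    (hdim : ¬ FiniteDimensional ℝ (Lp ℝ p μ)) :
    ∃ A : ℕ → Set Ω, (∀ n, MeasurableSet (A n)) ∧ (∀ n, μ (A n) ≠ 0) ∧ (∀ n, μ (A n) ≠ ∞) ∧
      Pairwise (Function.onFun Disjoint A) := by
  let T := {A : Set Ω // ¬ FiniteDimensional ℝ (indicatorSpan μ p A)}
  have step : ∀ A : T, ∃ B ⊆ A.1, MeasurableSet B ∧ μ B ≠ 0 ∧ μ B ≠ ∞ ∧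
      ¬ FiniteDimensional ℝ (indicatorSpan μ p (A.1 \ B)) := fun A =>
    exists_subset_not_finiteDimensional_diff A.2
  choose B hBA hB hB0 hBt hdiff using step
  let s : ℕ → T := fun n => Nat.rec
    ⟨univ, fun _ => hdim (finiteDimensional_of_indicatorSpan_univ hp)⟩
    (fun _ A => ⟨A.1 \ B A, hdiff A⟩) n
  have hs : ∀ n, (s (n + 1)).1 = (s n).1 \ B (s n) := fun n => rfl
  have hanti : Antitone fun n => (s n).1 := antitone_nat_of_succ_le fun n => by
    rw [hs]
    exact sdiff_subset
  refine ⟨fun n => B (s n), fun n => hB _, fun n => hB0 _, fun n => hBt _, ?_⟩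
  refine (pairwise_disjoint_on _).2 fun m n hmn => ?_
  refine disjoint_left.2 fun t ht ht' => ?_
  have := hanti (Nat.succ_le_of_lt hmn) (hBA _ ht')
  exact this.2 ht

end DisjointSets

/-! ### 2-smoothness of `Lp` -/

/-- Since `(a ± b) ^ 2 = (a ^ 2 + b ^ 2) ± 2 * a * b`, the inequality for `k` applied to `a ^ 2 + b
^ 2` and `2 * a * b` yields the next one, with `2 * K + 1`. -/
theorem exists_two_point_inequality_two_pow (k : ℕ) :
    ∃ K : ℝ, 1 ≤ K ∧ ∀ a b : ℝ,
      ((a + b) ^ 2) ^ 2 ^ k + ((a - b) ^ 2) ^ 2 ^ k ≤ 2 * (a ^ 2 + K * b ^ 2) ^ 2 ^ k := by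
  induction k with
  | zero => exact ⟨1, le_rfl, fun a b => by simp only [pow_zero, pow_one]; linarith⟩
  | succ k ih =>
    obtain ⟨K, hK, h⟩ := ih
    refine ⟨2 * K + 1, by linarith, fun a b => ?_⟩
    rw [pow_succ' 2 k, pow_mul, pow_mul, pow_mul]
    calc _ = (((a ^ 2 + b ^ 2) + 2 * a * b) ^ 2) ^ 2 ^ k +
          (((a ^ 2 + b ^ 2) - 2 * a * b) ^ 2) ^ 2 ^ k := by ring_nf
      _ ≤ 2 * ((a ^ 2 + b ^ 2) ^ 2 + K * (2 * a * b) ^ 2) ^ 2 ^ k := h _ _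
      _ ≤ _ := by
        gcongr
        have : 0 ≤ (K + K ^ 2) * b ^ 4 := by positivity
        nlinarith

theorem rpow_half_add_le {u v t : ℝ} (hu : 0 ≤ u) (hv : 0 ≤ v) (ht : 1 ≤ t) :
    (1 / 2 * u + 1 / 2 * v) ^ t ≤ 1 / 2 * u ^ t + 1 / 2 * v ^ t := by
  have := (convexOn_rpow ht).2 (mem_Ici.2 hu) (mem_Ici.2 hv) (by norm_num : (0 : ℝ) ≤ 1 / 2)
    (by norm_num : (0 : ℝ) ≤ 1 / 2) (by norm_num)
  simpa only [smul_eq_mul] using this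

/-- Power means reduce `s` to a larger power of two. -/
theorem exists_two_point_inequality {s : ℝ} (hs : 1 ≤ s) :
    ∃ K : ℝ, 1 ≤ K ∧ ∀ a b : ℝ,
      ((a + b) ^ 2) ^ s + ((a - b) ^ 2) ^ s ≤ 2 * (a ^ 2 + K * b ^ 2) ^ s := by
  obtain ⟨k, hk⟩ := pow_unbounded_of_one_lt s (one_lt_two (α := ℝ))
  obtain ⟨K, hK, h⟩ := exists_two_point_inequality_two_pow k
  refine ⟨K, hK, fun a b => ?_⟩
  set n : ℝ := 2 ^ k with hn
  have hs0 : 0 < s := by linarith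
  have hn0 : 0 < n := by positivity
  have hw : 0 ≤ a ^ 2 + K * b ^ 2 := by positivity
  have hpow : ∀ x : ℝ, 0 ≤ x → (x ^ s) ^ (n / s) = x ^ 2 ^ k := fun x hx => by
    rw [← Real.rpow_mul hx, mul_div_cancel₀ _ hs0.ne', hn, ← Real.rpow_natCast]
    norm_cast
  have h₁ := rpow_half_add_le (u := ((a + b) ^ 2) ^ s) (v := ((a - b) ^ 2) ^ s) (t := n / s)
    (by positivity) (by positivity) (by rw [le_div_iff₀ hs0]; linarith)
  rw [hpow _ (by positivity), hpow _ (by positivity)] at h₁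
  have h₂ : (1 / 2 * ((a + b) ^ 2) ^ s + 1 / 2 * ((a - b) ^ 2) ^ s) ^ (n / s) ≤
      ((a ^ 2 + K * b ^ 2) ^ s) ^ (n / s) := by
    rw [hpow _ hw]
    linarith [h a b]
  have h₃ := (Real.rpow_le_rpow_iff (by positivity) (by positivity) (by positivity)).1 h₂
  linarith

section LpSmooth

variable {Ω : Type*} [MeasurableSpace Ω] {μ : Measure Ω} {p : ℝ≥0∞}

theorem Lp.ofReal_norm_rpow [Fact (1 ≤ p)] (hp : p ≠ ∞) (x : Lp ℝ p μ) :
    ENNReal.ofReal (‖x‖ ^ p.toReal) = ∫⁻ t, ‖x t‖ₑ ^ p.toReal ∂μ := by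
  have hp0 : p ≠ 0 := (zero_lt_one.trans_le Fact.out).ne'
  have hpos := ENNReal.toReal_pos hp0 hp
  rw [← ENNReal.ofReal_rpow_of_nonneg (norm_nonneg x) hpos.le, ofReal_norm, Lp.enorm_def,
    eLpNorm_eq_lintegral_rpow_enorm_toReal hp0 hp, ← ENNReal.rpow_mul, one_div,
    inv_mul_cancel₀ hpos.ne', ENNReal.rpow_one]

theorem Lp.norm_add_rpow_of_disjoint [Fact (1 ≤ p)] (hp : p ≠ ∞) {x y : Lp ℝ p μ}
    (h : ∀ᵐ t ∂μ, x t = 0 ∨ y t = 0) :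
    ‖x + y‖ ^ p.toReal = ‖x‖ ^ p.toReal + ‖y‖ ^ p.toReal := by
  have hp0 : p ≠ 0 := (zero_lt_one.trans_le Fact.out).ne'
  have hpos := ENNReal.toReal_pos hp0 hp
  rw [← ENNReal.ofReal_eq_ofReal_iff (by positivity) (by positivity),
    ENNReal.ofReal_add (by positivity) (by positivity), Lp.ofReal_norm_rpow hp,
    Lp.ofReal_norm_rpow hp, Lp.ofReal_norm_rpow hp,
    ← lintegral_add_left' ((Lp.aestronglyMeasurable x).enorm.pow_const _)]
  refine lintegral_congr_ae ?_
  filter_upwards [h, Lp.coeFn_add x y] with t ht hadd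
  rw [hadd, Pi.add_apply]
  rcases ht with ht | ht <;> simp [ht, hpos]

/-- Integrate the two-point inequality with exponent `s = p / 2`, apply Minkowski in `L_s` to `x ^ 2
+ K * h ^ 2`, and return to squares by convexity of `t ^ s`. -/
theorem Lp.exists_two_smooth [Fact (1 ≤ p)] (hp2 : 2 ≤ p) (hp : p ≠ ∞) :
    ∃ K : ℝ, 0 ≤ K ∧ ∀ x h : Lp ℝ p μ,
      ‖x + h‖ ^ 2 + ‖x - h‖ ^ 2 ≤ 2 * ‖x‖ ^ 2 + 2 * K * ‖h‖ ^ 2 := by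
  have hp0 : p ≠ 0 := (zero_lt_one.trans_le Fact.out).ne'
  have hq2 : 2 ≤ p.toReal := by simpa using ENNReal.toReal_mono hp hp2
  set q := p.toReal
  set s := q / 2 with hs
  have hs1 : 1 ≤ s := by linarith
  have hs0 : 0 < s := by linarith
  obtain ⟨K, hK, hKab⟩ := exists_two_point_inequality hs1
  refine ⟨K, by linarith, fun x h => ?_⟩
  have hsq : ∀ a : ℝ, 0 ≤ a → (a ^ 2) ^ s = a ^ q := fun a ha => by
    rw [← Real.rpow_natCast, ← Real.rpow_mul ha, hs]
    congr 1
    push_cast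
    ring
  have hsqe : ∀ a : ℝ≥0∞, (a ^ 2) ^ s = a ^ q := fun a => by
    rw [← ENNReal.rpow_natCast, ← ENNReal.rpow_mul, hs]
    congr 1
    push_cast
    ring
  have hpt : ∀ a b : ℝ, ‖a + b‖ₑ ^ q + ‖a - b‖ₑ ^ q ≤
      2 * (‖a‖ₑ ^ 2 + ENNReal.ofReal K * ‖b‖ₑ ^ 2) ^ s := fun a b => by
    have := hKab a b
    rw [← sq_abs (a + b), ← sq_abs (a - b), hsq _ (abs_nonneg _), hsq _ (abs_nonneg _),
      ← sq_abs a, ← sq_abs b] at this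
    have := ENNReal.ofReal_le_ofReal this
    rw [ENNReal.ofReal_add (by positivity) (by positivity), ENNReal.ofReal_mul (by norm_num),
      ← ENNReal.ofReal_rpow_of_nonneg (by positivity) (by linarith),
      ← ENNReal.ofReal_rpow_of_nonneg (by positivity) (by linarith),
      ← ENNReal.ofReal_rpow_of_nonneg (by positivity) (by linarith),
      ENNReal.ofReal_add (by positivity) (by positivity), ENNReal.ofReal_mul (by linarith),
      ENNReal.ofReal_pow (by positivity), ENNReal.ofReal_pow (by positivity)] at this
    simpa [← Real.enorm_eq_ofReal_abs] using this
  have hmx : AEMeasurable (fun t => ‖x t‖ₑ ^ 2) μ :=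
    (Lp.aestronglyMeasurable x).enorm.pow_const _
  have hmh : AEMeasurable (fun t => ENNReal.ofReal K * ‖h t‖ₑ ^ 2) μ :=
    ((Lp.aestronglyMeasurable h).enorm.pow_const _).const_mul _
  have hint : ENNReal.ofReal (‖x + h‖ ^ q) + ENNReal.ofReal (‖x - h‖ ^ q) ≤
      2 * ∫⁻ t, (‖x t‖ₑ ^ 2 + ENNReal.ofReal K * ‖h t‖ₑ ^ 2) ^ s ∂μ := by
    rw [Lp.ofReal_norm_rpow hp, Lp.ofReal_norm_rpow hp,
      ← lintegral_add_left' ((Lp.aestronglyMeasurable _).enorm.pow_const _),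
      ← lintegral_const_mul' _ _ (by simp)]
    refine lintegral_mono_ae ?_
    filter_upwards [Lp.coeFn_add x h, Lp.coeFn_sub x h] with t h₁ h₂
    rw [h₁, h₂]
    exact hpt _ _
  have hroot : ∀ y : Lp ℝ p μ, (∫⁻ t, (‖y t‖ₑ ^ 2) ^ s ∂μ) ^ (1 / s) =
      ENNReal.ofReal (‖y‖ ^ 2) := fun y => by
    simp only [hsqe]
    rw [← Lp.ofReal_norm_rpow hp, ← hsq _ (norm_nonneg y),
      ENNReal.ofReal_rpow_of_nonneg (by positivity) (by positivity), ← Real.rpow_mul (by positivity),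
      mul_one_div_cancel hs0.ne', Real.rpow_one]
  have hmink := ENNReal.lintegral_Lp_add_le hmx hmh hs1
  have hKh : (∫⁻ t, (ENNReal.ofReal K * ‖h t‖ₑ ^ 2) ^ s ∂μ) ^ (1 / s) =
      ENNReal.ofReal (K * ‖h‖ ^ 2) := by
    simp only [ENNReal.mul_rpow_of_nonneg _ _ hs0.le]
    rw [lintegral_const_mul' _ _ (by simp [hs0.le]), ENNReal.mul_rpow_of_nonneg _ _ (by positivity),
      hroot, ← ENNReal.rpow_mul, mul_one_div_cancel hs0.ne', ENNReal.rpow_one,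
      ENNReal.ofReal_mul (by linarith)]
  rw [hroot, hKh, ← ENNReal.ofReal_add (by positivity) (by positivity), one_div,
    ENNReal.rpow_inv_le_iff hs0, ENNReal.ofReal_rpow_of_nonneg (by positivity) hs0.le] at hmink
  have hreal : ‖x + h‖ ^ q + ‖x - h‖ ^ q ≤ 2 * (‖x‖ ^ 2 + K * ‖h‖ ^ 2) ^ s := by
    rw [← ENNReal.ofReal_le_ofReal_iff (by positivity),
      ENNReal.ofReal_add (by positivity) (by positivity), ENNReal.ofReal_mul (by norm_num)]
    refine hint.trans ?_
    simp only [ENNReal.ofReal_ofNat]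
    gcongr
    exact hmink
  have h₁ := rpow_half_add_le (sq_nonneg ‖x + h‖) (sq_nonneg ‖x - h‖) hs1
  rw [hsq _ (norm_nonneg _), hsq _ (norm_nonneg _)] at h₁
  have h₂ := (Real.rpow_le_rpow_iff (by positivity) (by positivity) hs0).1
    (h₁.trans (by linarith : _ ≤ (‖x‖ ^ 2 + K * ‖h‖ ^ 2) ^ s))
  linarith

/-! ### Normalized indicators and their biorthogonal functionals -/

/-- The indicator of a set of finite positive measure, normalized in `Lp`. -/
noncomputable def normalizedIndicator (p : ℝ≥0∞) {A : Set Ω} (hA : MeasurableSet A)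
    (hμA : μ A ≠ ∞) : Lp ℝ p μ :=
  indicatorConstLp p hA hμA (μ.real A ^ (-(1 / p.toReal)))

theorem norm_normalizedIndicator (hp0 : p ≠ 0) (hp : p ≠ ∞) {A : Set Ω} (hA : MeasurableSet A)
    (hμA : μ A ≠ ∞) (hA0 : μ A ≠ 0) : ‖normalizedIndicator p hA hμA‖ = 1 := by
  have hpos : 0 < μ.real A := ENNReal.toReal_pos hA0 hμA
  rw [normalizedIndicator, norm_indicatorConstLp hp0 hp, Real.norm_eq_abs,
    abs_of_pos (by positivity), ← Real.rpow_add hpos, neg_add_cancel, Real.rpow_zero]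

theorem norm_setIntegral_le_Lp [hp1 : Fact (1 ≤ p)] (hp : p ≠ ∞) {A : Set Ω} (hμA : μ A ≠ ∞)
    (x : Lp ℝ p μ) :
    IntegrableOn x A μ ∧ ‖∫ t in A, x t ∂μ‖ ≤ ‖x‖ * μ.real A ^ (1 - 1 / p.toReal) := by
  have : IsFiniteMeasure (μ.restrict A) := ⟨by simpa using hμA.lt_top⟩
  have hpq : 1 ≤ p.toReal := by simpa using ENNReal.toReal_mono hp hp1.out
  have hexp : 0 ≤ 1 - 1 / p.toReal := by
    rw [sub_nonneg, div_le_one (by linarith)]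
    exact hpq
  have hx : MemLp x p (μ.restrict A) := (Lp.memLp x).restrict A
  have hi : IntegrableOn x A μ := memLp_one_iff_integrable.1 (hx.mono_exponent hp1.out)
  refine ⟨hi, ?_⟩
  have h₁ := eLpNorm_le_eLpNorm_mul_rpow_measure_univ hp1.out hx.1
  have h₂ : eLpNorm x p (μ.restrict A) ≤ ‖x‖ₑ := by
    rw [Lp.enorm_def]
    exact eLpNorm_mono_measure _ Measure.restrict_le_self
  have h₃ : ‖∫ t in A, x t ∂μ‖ₑ ≤ ‖x‖ₑ * μ A ^ (1 - 1 / p.toReal) := by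
    refine (enorm_integral_le_lintegral_enorm _).trans ?_
    rw [← eLpNorm_one_eq_lintegral_enorm]
    refine h₁.trans ?_
    rw [ENNReal.toReal_one, one_div_one, Measure.restrict_apply_univ]
    gcongr
  have h₄ := ENNReal.toReal_mono
    (ENNReal.mul_ne_top (by simp) (ENNReal.rpow_ne_top_of_nonneg hexp hμA)) h₃
  rwa [ENNReal.toReal_mul, ← ENNReal.toReal_rpow, toReal_enorm, toReal_enorm] at h₄

/-- The functional of norm at most one on `Lp` that is dual to the normalized indicator of `A`. -/
noncomputable def normalizedIntegral [Fact (1 ≤ p)] (hp : p ≠ ∞) {A : Set Ω} (hμA : μ A ≠ ∞)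
    (hA0 : μ A ≠ 0) : Lp ℝ p μ →L[ℝ] ℝ :=
  LinearMap.mkContinuous
    { toFun := fun x => μ.real A ^ (1 / p.toReal - 1) * ∫ t in A, x t ∂μ
      map_add' := fun x y => by
        rw [← mul_add, ← integral_add (norm_setIntegral_le_Lp hp hμA x).1
          (norm_setIntegral_le_Lp hp hμA y).1]
        congr 1
        exact integral_congr_ae (ae_restrict_of_ae (Lp.coeFn_add x y))
      map_smul' := fun c x => by
        rw [RingHom.id_apply, smul_eq_mul, mul_left_comm, ← integral_const_mul c]
        congr 1
        exact integral_congr_ae (ae_restrict_of_ae (Lp.coeFn_smul c x)) } 1 fun x => by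
    have hpos : 0 < μ.real A := ENNReal.toReal_pos hA0 hμA
    change ‖μ.real A ^ (1 / p.toReal - 1) * ∫ t in A, x t ∂μ‖ ≤ 1 * ‖x‖
    rw [norm_mul, Real.norm_eq_abs, abs_of_pos (by positivity)]
    calc _ ≤ μ.real A ^ (1 / p.toReal - 1) * (‖x‖ * μ.real A ^ (1 - 1 / p.toReal)) := by
          gcongr
          exact (norm_setIntegral_le_Lp hp hμA x).2
      _ = 1 * ‖x‖ := by
        rw [mul_left_comm, ← Real.rpow_add hpos, sub_add_sub_cancel, sub_self, Real.rpow_zero,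
          one_mul, mul_one]

theorem normalizedIntegral_apply [Fact (1 ≤ p)] (hp : p ≠ ∞) {A : Set Ω} (hμA : μ A ≠ ∞)
    (hA0 : μ A ≠ 0) (x : Lp ℝ p μ) : normalizedIntegral hp hμA hA0 x =
      μ.real A ^ (1 / p.toReal - 1) * ∫ t in A, x t ∂μ :=
  rfl

theorem abs_normalizedIntegral_le [Fact (1 ≤ p)] (hp : p ≠ ∞) {A : Set Ω} (hμA : μ A ≠ ∞)
    (hA0 : μ A ≠ 0) (x : Lp ℝ p μ) : |normalizedIntegral hp hμA hA0 x| ≤ ‖x‖ := by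
  have := (normalizedIntegral hp hμA hA0).le_of_opNorm_le
    (LinearMap.mkContinuous_norm_le _ zero_le_one _) x
  rwa [one_mul] at this

theorem normalizedIntegral_normalizedIndicator [Fact (1 ≤ p)] (hp : p ≠ ∞) {A B : Set Ω}
    (hμA : μ A ≠ ∞) (hA0 : μ A ≠ 0) (hB : MeasurableSet B) (hμB : μ B ≠ ∞) :
    normalizedIntegral hp hμA hA0 (normalizedIndicator p hB hμB) =
      μ.real A ^ (1 / p.toReal - 1) * (μ.real (B ∩ A) * μ.real B ^ (-(1 / p.toReal))) := by
  rw [normalizedIntegral_apply, normalizedIndicator,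
    integral_congr_ae (ae_restrict_of_ae indicatorConstLp_coeFn), integral_indicator_const _ hB,
    measureReal_restrict_apply hB, smul_eq_mul]

end LpSmooth

/-! ### Disjoint normalized indicators and the two cases of the theorem -/

section LpMain

variable {Ω : Type*} [MeasurableSpace Ω] {μ : Measure Ω} {p : ℝ≥0∞} [Fact (1 ≤ p)]
  {ι : Type*} {A : ι → Set Ω}

theorem normalizedIntegral_biorthogonal [DecidableEq ι] (hp : p ≠ ∞)
    (hA : ∀ i, MeasurableSet (A i)) (hA0 : ∀ i, μ (A i) ≠ 0) (hμA : ∀ i, μ (A i) ≠ ∞)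
    (hd : Pairwise (Function.onFun Disjoint A)) (i j : ι) :
    normalizedIntegral hp (hμA i) (hA0 i) (normalizedIndicator p (hA j) (hμA j)) =
      if i = j then 1 else 0 := by
  rw [normalizedIntegral_normalizedIndicator]
  split_ifs with h
  · subst h
    have hpos : 0 < μ.real (A i) := ENNReal.toReal_pos (hA0 i) (hμA i)
    rw [inter_self]
    nth_rewrite 2 [← Real.rpow_one (μ.real (A i))]
    rw [← Real.rpow_add hpos, ← Real.rpow_add hpos]
    ring_nf
    exact Real.rpow_zero _
  · rw [(hd (Ne.symm h)).inter_eq]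
    simp

theorem norm_cubeNode_normalizedIndicator_rpow_le (hp : p ≠ ∞) {A : ℕ → Set Ω}
    (hA : ∀ i, MeasurableSet (A i)) (hA0 : ∀ i, μ (A i) ≠ 0) (hμA : ∀ i, μ (A i) ≠ ∞)
    (hd : Pairwise (Function.onFun Disjoint A)) {ε : ℝ} (hε : 0 < ε) (w : List Bool) :
    ‖cubeNode (fun j => normalizedIndicator p (hA j) (hμA j)) ε w‖ ^ p.toReal ≤
      w.length * ε ^ p.toReal := by
  have hp0 : p ≠ 0 := (zero_lt_one.trans_le Fact.out).ne'
  have hpos := ENNReal.toReal_pos hp0 hp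
  have hvanish : ∀ i (c : ℝ), ∀ᵐ t ∂μ, t ∉ A i →
      (c • normalizedIndicator p (hA i) (hμA i) : Lp ℝ p μ) t = 0 := fun i c => by
    filter_upwards [Lp.coeFn_smul c (normalizedIndicator p (hA i) (hμA i)),
      indicatorConstLp_coeFn_notMem (p := p) (hs := hA i) (hμs := hμA i)
        (c := μ.real (A i) ^ (-(1 / p.toReal)))] with t h₁ h₂ ht
    rw [h₁, Pi.smul_apply, normalizedIndicator, h₂ ht, smul_zero]
  -- The induction also carries that the node vanishes on the sets not yet used, so the next term
  -- has disjoint support and the `p`-th powers of norms add.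
  have key : ∀ w : List Bool,
      (∀ i, w.length ≤ i → ∀ᵐ t ∂μ, t ∈ A i →
        cubeNode (fun j => normalizedIndicator p (hA j) (hμA j)) ε w t = 0) ∧
      ‖cubeNode (fun j => normalizedIndicator p (hA j) (hμA j)) ε w‖ ^ p.toReal ≤
        w.length * ε ^ p.toReal := by
    intro w
    induction w with
    | nil =>
      refine ⟨fun i _ => ?_, by simp [cubeNode, hpos.ne']⟩
      filter_upwards [Lp.coeFn_zero ℝ p μ] with t ht _
      exact ht
    | cons b w ih =>
      refine ⟨fun i hi => ?_, ?_⟩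
      · rw [List.length_cons] at hi
        filter_upwards [ih.1 i (by omega), hvanish w.length (boolSign b * ε), Lp.coeFn_add
          (cubeNode (fun j => normalizedIndicator p (hA j) (hμA j)) ε w)
          ((boolSign b * ε) • normalizedIndicator p (hA w.length) (hμA w.length))]
          with t h₁ h₂ h₃ ht
        have hne : t ∉ A w.length := disjoint_left.1 (hd (by omega : i ≠ w.length)) ht
        rw [cubeNode, h₃, Pi.add_apply, h₁ ht, h₂ hne, add_zero]
      · rw [cubeNode, Lp.norm_add_rpow_of_disjoint hp, norm_smul,
          norm_normalizedIndicator hp0 hp _ _ (hA0 _), mul_one, norm_mul, Real.norm_eq_abs,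
          abs_boolSign, one_mul, Real.norm_eq_abs, abs_of_pos hε, List.length_cons]
        · push_cast
          linarith [ih.2]
        · filter_upwards [ih.1 w.length le_rfl, hvanish w.length (boolSign b * ε)] with t h₁ h₂
          by_cases ht : t ∈ A w.length
          · exact Or.inl (h₁ ht)
          · exact Or.inr (h₂ ht)
  exact (key w).2

/-- For `p = 1` the functionals are plain integrals over disjoint sets, so their absolute values sum
to at most `∫ |x|`. -/
theorem summable_normalizedIntegral_one {ι : Type*} [Countable ι] {A : ι → Set Ω}
    (hA : ∀ i, MeasurableSet (A i)) (hA0 : ∀ i, μ (A i) ≠ 0) (hμA : ∀ i, μ (A i) ≠ ∞)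
    (hd : Pairwise (Function.onFun Disjoint A)) (x : Lp ℝ 1 μ) :
    (Summable fun i => |normalizedIntegral ENNReal.one_ne_top (hμA i) (hA0 i) x|) ∧
      ∑' i, |normalizedIntegral ENNReal.one_ne_top (hμA i) (hA0 i) x| ≤ ‖x‖ := by
  have hi : Integrable (fun t => ‖x t‖) μ := (L1.integrable_coeFn x).norm
  have hsum : HasSum (fun i => ∫ t in A i, ‖x t‖ ∂μ) (∫ t in ⋃ i, A i, ‖x t‖ ∂μ) :=
    hasSum_integral_iUnion hA hd hi.integrableOn
  have hle : ∀ i, |normalizedIntegral ENNReal.one_ne_top (hμA i) (hA0 i) x| ≤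
      ∫ t in A i, ‖x t‖ ∂μ := fun i => by
    rw [normalizedIntegral_apply, ENNReal.toReal_one, one_div_one, sub_self, Real.rpow_zero, one_mul]
    rw [← Real.norm_eq_abs]
    exact norm_integral_le_integral_norm _
  have hs := Summable.of_nonneg_of_le (fun i => abs_nonneg _) hle hsum.summable
  refine ⟨hs, (hs.tsum_le_tsum hle hsum.summable).trans ?_⟩
  rw [hsum.tsum_eq, L1.norm_eq_integral_norm]
  exact setIntegral_le_integral hi (Filter.Eventually.of_forall fun t => norm_nonneg _)

end LpMain

theorem exists_quadApprox_not_deltaConvexOn_Lp {Ω : Type*} [MeasurableSpace Ω] (μ : Measure Ω)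
    (p : ℝ≥0∞) [Fact (1 ≤ p)] (hp : p = 1 ∨ (2 < p ∧ p < ∞))
    (hdim : ¬ FiniteDimensional ℝ (Lp ℝ p μ)) :
    ∃ (C : ℝ) (f : Lp ℝ p μ → ℝ) (D : Lp ℝ p μ → Lp ℝ p μ →L[ℝ] ℝ), 0 ≤ C ∧ QuadApprox C f D ∧
      ∀ U ∈ 𝓝 (0 : Lp ℝ p μ), ¬ DeltaConvexOn U f := by
  classical
  have hpt : p ≠ ∞ := by
    rcases hp with rfl | hp
    · simp
    · exact hp.2.ne
  obtain ⟨A, hA, hA0, hμA, hd⟩ := exists_seq_disjoint_of_not_finiteDimensional_Lp hpt hdim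
  rcases hp with rfl | ⟨hp2, -⟩
  · have hinj : Function.Injective (Encodable.encode : List Bool → ℕ) := Encodable.encode_injective
    have hd' : Pairwise (Function.onFun Disjoint fun u : List Bool => A (Encodable.encode u)) :=
      hd.comp_of_injective hinj
    have hs := summable_normalizedIntegral_one (fun u : List Bool => hA (Encodable.encode u))
      (fun u => hA0 _) (fun u => hμA _) hd'
    exact exists_not_deltaConvexOn_of_biorthogonal_l1
      (e := fun u => normalizedIndicator 1 (hA (Encodable.encode u)) (hμA _))
      (fun u => (norm_normalizedIndicator one_ne_zero hpt _ _ (hA0 _)).le)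
      (normalizedIntegral_biorthogonal hpt (fun u : List Bool => hA (Encodable.encode u))
        (fun u => hA0 _) (fun u => hμA _) hd')
      (fun x => (hs x).1) (fun x => (hs x).2)
  · obtain ⟨K, hK, hE⟩ := Lp.exists_two_smooth (μ := μ) hp2.le hpt
    have hq : 2 < p.toReal := by
      simpa using (ENNReal.toReal_lt_toReal (by simp) hpt).2 hp2
    -- Pairing splits the sequence of sets into infinitely many sequences, one for each cube.
    have hinj : Function.Injective fun z : ℕ × ℕ => Nat.pair z.1 z.2 :=
      fun a b h => Prod.ext (Nat.pair_eq_pair.1 h).1 (Nat.pair_eq_pair.1 h).2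
    have hd' : Pairwise (Function.onFun Disjoint fun z : ℕ × ℕ => A (Nat.pair z.1 z.2)) :=
      hd.comp_of_injective hinj
    exact exists_not_deltaConvexOn_of_two_smooth hK hq hE
      (e := fun z => normalizedIndicator p (hA (Nat.pair z.1 z.2)) (hμA _))
      (fun i x => abs_normalizedIntegral_le hpt (hμA _) (hA0 _) x)
      (normalizedIntegral_biorthogonal hpt (fun z : ℕ × ℕ => hA (Nat.pair z.1 z.2))
        (fun u => hA0 _) (fun u => hμA _) hd')
      (fun m ε w hε => norm_cubeNode_normalizedIndicator_rpow_le hpt (fun j => hA (Nat.pair m j))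
        (fun j => hA0 _) (fun j => hμA _)
        (hd.comp_of_injective fun a b h => (Nat.pair_eq_pair.1 h).2) hε w)

theorem mainTheorem10 {Ω : Type*} [MeasurableSpace Ω] (μ : Measure Ω)
    (p : ℝ≥0∞) [Fact (1 ≤ p)] (hp : p = 1 ∨ (2 < p ∧ p < ∞))
    (hdim : ¬ FiniteDimensional ℝ (Lp ℝ p μ)) :
    ∃ f : Lp ℝ p μ → ℝ, Continuous f ∧
      (∀ U ∈ 𝓝 (0 : Lp ℝ p μ), Convex ℝ U → ¬ DeltaConvexOn U f) ∧
      ∀ φ : ℝ → Lp ℝ p μ, DeltaConvexCurveOn (Ioo 0 1) φ →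
        DeltaConvexOn (Ioo (0 : ℝ) 1) (f ∘ φ) := by
  obtain ⟨C, f, D, hC, hf, hU⟩ := exists_quadApprox_not_deltaConvexOn_Lp μ p hp hdim
  exact ⟨f, hf.continuous, fun U hU₀ _ => hU U hU₀,
    fun φ hφ => hf.deltaConvexOn_comp hC zero_lt_one hφ⟩
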